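/- Setting. Let $(X_i,W_i)$, $i\ge 1$, be iid with law $P$ on $\mathbb{R}^{d_X}\times\mathbb{R}^{d_W}$, $d_X\ge 1$; let $\Theta\subseteq\mathbb{R}^d$, let $m(\cdot,\theta):\mathbb{R}^{d_W}\to\mathbb{R}^{d_Y}$ be measurable for each $\theta\in\Theta$, and let $\mathcal{G}$ be a class of measurable functions $g=(g_1,\dots,g_{d_Y}):\mathbb{R}^{d_X}\to\mathbb{R}_+^{d_Y}$. The identified set is $$\Theta_0(P)=\{\theta\in\Theta : E_P[m(W_i,\theta)\mid X_i]\ge 0\ \ P\text{-a.s.}\},$$ and $\bar m(\theta,x)$ denotes a version of $E_P[m(W_i,\theta)\mid X_i=x]$. Write $\hat\mu_{n,j}(\theta,g)=\frac1n\sum_{i=1}^n m_j(W_i,\theta)g_j(X_i)$. For $S:\mathbb{R}^{d_Y}\to\mathbb{R}_+$, (possibly data dependent) weights $\omega_{n}(\theta,g)\in\mathbb{R}^{d_Y}$ and (possibly data dependent) critical values $\hat c_n$, put $$T_{n,\omega}(\theta)=\sup_{g\in\mathcal{G}} S\big(\omega_{n,1}(\theta,g)\hat\mu_{n,1}(\theta,g),\dots,\omega_{n,d_Y}(\theta,g)\hat\mu_{n,d_Y}(\theta,g)\big),\qquad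 \mathcal{C}_{n,\omega}(\hat c_n)=\{\theta\in\Theta : \sqrt n\,T_{n,\omega}(\theta)\le \hat c_n\}.$$ Let $d_H$ be the ($[0,\infty]$-valued) Hausdorff distance for the Euclidean norm. Assumptions. 1. $0\le\omega_{n,j}(\theta,g)\le\overline\omega$ for some $\overline\omega<\infty$ and all $n,j,\theta,g$; and, for some $c>0$, $\hat c_n\ge c$ a.s. for all $n$. 2. $g(X_i)$ and $m(W_i,\theta)$ are almost surely bounded, uniformly in $g\in\mathcal{G}$ and $\theta\in\Theta$, and $|m_j(W_i,\theta)g_j(X_i)|\le\overline Y$ a.s. for all $j,\theta,g$. For all $n$, $\theta\in\Theta$ and $j$, $\inf_{g\in\mathcal{G}}\sum_{i\le n} m_j(w_i,\theta)g_j(x_i)$ is a measurable function of the sample $(x_i,w_i)_{i\le n}$, up to $P^{n}$-null sets. 3. Let $\mathcal{F}_{j,1}$ be the class of functions $(x,w)\mapsto s\,m_j(w,\theta)g_j(x)+t$ with $\theta\in\Theta$, $g\in\mathcal{G}$, $s,t\in[-(\overline Y\vee1),\overline Y\vee1]$, and $\mathcal{F}_{j,2}$ the class of their squares. For some $A,V>0$,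 $N(\varepsilon,\mathcal{F}_{j,i},L_1(Q))\le A\varepsilon^{-V}$ for all $j$, $i=1,2$, $0<\varepsilon<1$ and all probability measures $Q$, where $N(\varepsilon,\mathcal{F},L_1(Q))$ is the least number of measurable functions such that each $f\in\mathcal{F}$ is within $\varepsilon$ of one of them in $L_1(Q)$. 4. $S(t)>0$ if and only if $t_j<0$ for some $j$; and for some $K_{S,1},K_{S,2}>0$ and every $c>0$, $S(t)\ge c$ implies $t_j\le -cK_{S,1}$ for some $j$, and $S(t)\le c$ implies $t_j\ge -cK_{S,2}$ for all $j$. 5. Let $\alpha>0$. For some $\theta_0\in\partial\Theta_0(P)$ in the interior of $\Theta$ and some neighborhood $B(\theta_0)$ of $\theta_0$ (with $x$ ranging over the support of $X_i$): (i) $\bar m(\theta,x)$ is differentiable in $\theta$ with derivative bounded over $\theta\in B(\theta_0)$ and $x$. (ii) For some $\eta>0$ and all $\theta_0'\in\partial\Theta_0(P)\cap B(\theta_0)$, the set $\mathcal{X}_0(\theta_0')$ of points $x_0$ of the support of $X_i$ with $\min_k\bar m_k(\theta_0',x_0)=0$ is finite, with cardinality bounded uniformly in $\theta_0'$, and for all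 $x$ and all $j$ there is an $x_0\in\mathcal{X}_0(\theta_0')$ with $$|\bar m_j(\theta_0',x)|\ \ge\ \eta\left(\|x-x_0\|^\alpha\wedge\eta\right).$$ (iii) $X_i$ has bounded support and a bounded Lebesgue density. (iv) There is a path $t\mapsto\theta_t$ in $\Theta$ with $\theta_t\to\theta_0$ as $t\to0$ and $t\mapsto d(\theta_t,\theta_0)$ continuous for $t$ in a neighborhood of $0$. Conclusion. For some $\varepsilon>0$, $$P\left(n^{\alpha/(2d_X+2\alpha)}\,d_H\big(\mathcal{C}_{n,\omega}(\hat c_n),\Theta_0(P)\big)\ge\varepsilon\right)\longrightarrow 1\qquad(n\to\infty),$$ where probabilities of possibly non-measurable events are outer probabilities, and the complementary event has outer probability tending to $0$. -/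

import Mathlib

open MeasureTheory ProbabilityTheory Filter Topology Set
open scoped ENNReal NNReal

noncomputable section

namespace KS

/-- Euclidean space `ℝ^k` with the Euclidean norm. -/
abbrev E (k : ℕ) : Type := EuclideanSpace ℝ (Fin k)

variable {d dX dW dY : ℕ}

/-- An instrument function `g = (g_1, …, g_{dY})`, each `g_j : ℝ^{dX} → ℝ_+`. -/
abbrev Instr (dX dY : ℕ) : Type := E dX → Fin dY → ℝ≥0

/-- The identified set `Θ₀(P)`: parameters in `Θ` with
`E_P[m_j(W, θ) | X] ≥ 0` for all `j`, `P`-almost surely.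
Here `P` is the law of `(X, W)`. -/
def identifiedSet (Θ : Set (E d)) (m : E dW → E d → Fin dY → ℝ)
    (P : Measure (E dX × E dW)) : Set (E d) :=
  {θ | θ ∈ Θ ∧ ∀ᵐ z ∂P, ∀ j,
    0 ≤ (P[fun z => m z.2 θ j | MeasurableSpace.comap Prod.fst inferInstance]) z}

/-- `mbar θ x` is a version of `E_P[m(W, θ) | X = x]`, for every `θ ∈ Θ`. -/
def IsCondMeanVersion (Θ : Set (E d)) (m : E dW → E d → Fin dY → ℝ)
    (P : Measure (E dX × E dW)) (mbar : E d → E dX → Fin dY → ℝ) : Prop :=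
  ∀ θ ∈ Θ, ∀ j, Measurable (fun x => mbar θ x j) ∧
    (fun z : E dX × E dW => mbar θ z.1 j) =ᵐ[P]
      P[fun z => m z.2 θ j | MeasurableSpace.comap Prod.fst inferInstance]

/-- The sample moment `μ̂_{n,j}(θ, g) = (1/n) ∑_{i < n} m_j(W_i, θ) g_j(X_i)`. -/
def sampleMoment (m : E dW → E d → Fin dY → ℝ) (θ : E d) (g : Instr dX dY) (j : Fin dY)
    (n : ℕ) (z : ℕ → E dX × E dW) : ℝ :=
  (1 / (n : ℝ)) * ∑ i ∈ Finset.range n, m (z i).2 θ j * (g (z i).1 j : ℝ)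

/-- The weighted KS statistic
`sup_{g ∈ 𝒢} S(w_1(g) μ̂_{n,1}(θ, g), …, w_{dY}(g) μ̂_{n,dY}(θ, g))`, as an extended
nonnegative number. -/
def ksStat (m : E dW → E d → Fin dY → ℝ) (G : Set (Instr dX dY))
    (S : (Fin dY → ℝ) → ℝ≥0) (w : Instr dX dY → Fin dY → ℝ)
    (n : ℕ) (z : ℕ → E dX × E dW) (θ : E d) : ℝ≥0∞ :=
  ⨆ g ∈ G, (S (fun j => w g j * sampleMoment m θ g j n z) : ℝ≥0∞)

/-- The set estimate `{θ ∈ Θ | √n T_{n,ω}(θ) ≤ c}`, with weights `w θ g`. -/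
def setEstimate (Θ : Set (E d)) (m : E dW → E d → Fin dY → ℝ) (G : Set (Instr dX dY))
    (S : (Fin dY → ℝ) → ℝ≥0) (w : E d → Instr dX dY → Fin dY → ℝ)
    (n : ℕ) (z : ℕ → E dX × E dW) (c : ℝ) : Set (E d) :=
  {θ | θ ∈ Θ ∧
    ENNReal.ofReal (Real.sqrt n) * ksStat m G S (w θ) n z θ ≤ ENNReal.ofReal c}

/-- The finite set `T` of (measurable) centers covers the class `F` at radius `ε` in `L₁(Q)`;
the centers need not belong to `F`. -/
def IsL1Cover {Z : Type*} [MeasurableSpace Z] (Q : Measure Z) (ε : ℝ) (F : Set (Z → ℝ))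
    (T : Finset (Z → ℝ)) : Prop :=
  (∀ h ∈ T, Measurable h) ∧
    ∀ f ∈ F, ∃ h ∈ T, ∫⁻ z, ‖f z - h z‖ₑ ∂Q ≤ ENNReal.ofReal ε

/-- The covering number `N(ε, F, L₁(Q))`; it is `⊤` if there is no finite cover. -/
def coveringNumber {Z : Type*} [MeasurableSpace Z] (ε : ℝ) (F : Set (Z → ℝ))
    (Q : Measure Z) : ℕ∞ :=
  ⨅ (T : Finset (Z → ℝ)) (_ : IsL1Cover Q ε F T), (T.card : ℕ∞)

/-- The class of functions `s m_j(W, θ) g_j(X) + t` with `θ ∈ Θ`, `g ∈ 𝒢` and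
`s, t ∈ [-(Ybar ∨ 1), Ybar ∨ 1]`. -/
def classOne (Θ : Set (E d)) (m : E dW → E d → Fin dY → ℝ) (G : Set (Instr dX dY))
    (Ybar : ℝ) (j : Fin dY) : Set (E dX × E dW → ℝ) :=
  {f | ∃ θ ∈ Θ, ∃ g ∈ G, ∃ s ∈ Icc (-(max Ybar 1)) (max Ybar 1),
    ∃ t ∈ Icc (-(max Ybar 1)) (max Ybar 1),
      f = fun z => s * (m z.2 θ j * (g z.1 j : ℝ)) + t}

/-- The class of squares of the functions in `classOne`. -/
def classTwo (Θ : Set (E d)) (m : E dW → E d → Fin dY → ℝ) (G : Set (Instr dX dY))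
    (Ybar : ℝ) (j : Fin dY) : Set (E dX × E dW → ℝ) :=
  {f | ∃ h ∈ classOne Θ m G Ybar j, f = fun z => h z ^ 2}

/-- Polynomial bound on the uniform `L₁` covering numbers of both classes. -/
def CoveringAssumption (Θ : Set (E d)) (m : E dW → E d → Fin dY → ℝ) (G : Set (Instr dX dY))
    (Ybar : ℝ) : Prop :=
  ∃ A > (0 : ℝ), ∃ V > (0 : ℝ), ∀ j : Fin dY,
    ∀ F ∈ ({classOne Θ m G Ybar j, classTwo Θ m G Ybar j} : Set (Set (E dX × E dW → ℝ))),
      ∀ Q : Measure (E dX × E dW), IsProbabilityMeasure Q →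
        ∀ ε : ℝ, 0 < ε → ε < 1 →
          (coveringNumber ε F Q : ℝ≥0∞) ≤ ENNReal.ofReal (A * ε ^ (-V))

/-- The moments are almost surely bounded by `Ybar`. -/
def BoundedMoments (Θ : Set (E d)) (m : E dW → E d → Fin dY → ℝ) (G : Set (Instr dX dY))
    (P : Measure (E dX × E dW)) (Ybar : ℝ) : Prop :=
  0 ≤ Ybar ∧ ∀ θ ∈ Θ, ∀ g ∈ G, ∀ j, ∀ᵐ z ∂P, |m z.2 θ j * (g z.1 j : ℝ)| ≤ Ybar

/-- The condition on the function `S` that aggregates the moments. -/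
def SAssumption (S : (Fin dY → ℝ) → ℝ≥0) : Prop :=
  (∀ t, 0 < S t ↔ ∃ j, t j < 0) ∧
  ∃ K₁ > (0 : ℝ), ∃ K₂ > (0 : ℝ), ∀ c > (0 : ℝ), ∀ t,
    (c ≤ (S t : ℝ) → ∃ j, t j ≤ -(c * K₁)) ∧
    ((S t : ℝ) ≤ c → ∀ j, -(c * K₂) ≤ t j)

/-- The support of `X` under `P`. -/
def suppX (P : Measure (E dX × E dW)) : Set (E dX) := (P.map Prod.fst).support

/-- The contact set `𝒳₀(θ)`: points `x` of the support of `X` at which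
`min_k mbar_k(θ, x) = 0`. -/
def contactSet (P : Measure (E dX × E dW)) (mbar : E d → E dX → Fin dY → ℝ) (θ : E d) :
    Set (E dX) :=
  {x | x ∈ suppX P ∧ IsLeast (Set.range (mbar θ x)) 0}

/-- Upper bound on the smoothness of the conditional mean, with exponent `α`, near some
boundary point `θ₀` of the identified set `Θ₀` that is interior to `Θ`. -/
def SmoothnessUpper (Θ Θ₀ : Set (E d)) (P : Measure (E dX × E dW))
    (mbar : E d → E dX → Fin dY → ℝ) (α : ℝ) : Prop :=
  ∃ θ₀ ∈ frontier Θ₀ ∩ interior Θ, ∃ B ∈ 𝓝 θ₀,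
    -- (i) bounded derivative in the parameter
    (∃ K : ℝ, ∀ θ ∈ B, ∀ x ∈ suppX P, ∀ j,
      DifferentiableAt ℝ (fun θ' => mbar θ' x j) θ ∧
        ‖fderiv ℝ (fun θ' => mbar θ' x j) θ‖ ≤ K) ∧
    -- (ii) growth away from uniformly finitely many contact points
    (∃ η > (0 : ℝ), ∃ N : ℕ, ∀ θ' ∈ frontier Θ₀ ∩ B,
      (contactSet P mbar θ').encard ≤ N ∧
      ∀ x ∈ suppX P, ∀ j, ∃ x₀ ∈ contactSet P mbar θ',
        η * min (‖x - x₀‖ ^ α) η ≤ |mbar θ' x j|) ∧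
    -- (iii) bounded support and bounded density
    (Bornology.IsBounded (suppX P) ∧
      ∃ f : E dX → ℝ≥0∞, Measurable f ∧ P.map Prod.fst = volume.withDensity f ∧
        ∃ C : ℝ≥0, ∀ x, f x ≤ C) ∧
    -- (iv) a path in the parameter space
    (∃ path : ℝ → E d, (∀ t, path t ∈ Θ) ∧ Tendsto path (𝓝[≠] 0) (𝓝 θ₀) ∧
      ∃ V ∈ 𝓝 (0 : ℝ), ContinuousOn (fun t => dist (path t) θ₀) V)

/-- Measurability of the empirical process: the infimum over `𝒢` of each sample moment is a
measurable function of the sample, up to null sets. -/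
def MeasurableInf (Θ : Set (E d)) (m : E dW → E d → Fin dY → ℝ) (G : Set (Instr dX dY))
    (P : Measure (E dX × E dW)) : Prop :=
  ∀ n : ℕ, ∀ θ ∈ Θ, ∀ j, AEMeasurable
    (fun z : Fin n → E dX × E dW =>
      ⨅ g : G, ∑ i, m (z i).2 θ j * (g.1 (z i).1 j : ℝ))
    (Measure.pi fun _ : Fin n => P)

end KS

end

namespace KS

/-! ### Exponential inequalities on product spaces -/

section ProductSpace

variable {ι U : Type*} [Fintype ι] [MeasurableSpace U] {ν : Measure U} [IsProbabilityMeasure ν]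

/-! Some parameter θ at distance δ = ε n^(-γ), γ = α/(2 dX + 2α), from the identified set lies in
the set estimate with probability tending to one; the Hausdorff distance is then at least δ.

Let c be a frontier point of the identified set nearest to θ. Passing from c to θ lowers the
conditional means by O(δ), while at c they grow like ‖x - x₀‖^α away from the contact points. With
ρ^α a suitable multiple of δ, the means at θ can be negative only in boundedly many balls of radius
ρ, of total probability O(ρ^dX), and are at least a multiple of δ elsewhere
(`exists_local_alternatives`). About n ρ^dX observations fall in the balls and each costs O(δ). The
total has order n δ^(1 + dX/α), which is √n for exactly this γ, with a small constant if ε is small.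

The fluctuations must be controlled uniformly over instruments with no logarithmic loss. In a
Chernoff bound with parameter l = δ, the second-order term is linear in the weights g(x_i), so the
positive drift outside the balls pays for it. What remains is exp(-l τ√n/4) = exp(-const n^q), q =
dX/(2 dX + 2α), which beats a polynomial number of net points (`pi_exists_weighted_sum_lt_le`). This
is done with the X_i fixed, after writing W = φ(X, u) with u uniform and independent of X. -/

theorem integral_exp_le_of_abs_le_one {h : U → ℝ} (hm : Measurable h)
    (hb : ∀ᵐ u ∂ν, |h u| ≤ 1) :
    ∫ u, Real.exp (h u) ∂ν ≤ Real.exp (∫ u, h u ∂ν + ∫ u, h u ^ 2 ∂ν) := by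
  have hi : Integrable h ν := Integrable.of_bound hm.aestronglyMeasurable 1 hb
  have hi2 : Integrable (fun u => h u ^ 2) ν := by
    refine Integrable.of_bound (hm.pow_const 2).aestronglyMeasurable 1 ?_
    filter_upwards [hb] with u hu
    rw [Real.norm_eq_abs, abs_pow]
    exact pow_le_one₀ (abs_nonneg _) hu
  have hie : Integrable (fun u => Real.exp (h u)) ν := by
    refine Integrable.of_bound hm.exp.aestronglyMeasurable (Real.exp 1) ?_
    filter_upwards [hb] with u hu
    rw [Real.norm_eq_abs, Real.abs_exp]
    exact Real.exp_le_exp.2 ((le_abs_self _).trans hu)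
  calc ∫ u, Real.exp (h u) ∂ν ≤ ∫ u, (1 + (h u + h u ^ 2)) ∂ν := by
        refine integral_mono_ae hie ((integrable_const 1).add (hi.add hi2)) ?_
        filter_upwards [hb] with u hu
        have := (abs_le.1 (Real.abs_exp_sub_one_sub_id_le hu)).2
        linarith
    _ = 1 + (∫ u, h u ∂ν + ∫ u, h u ^ 2 ∂ν) := by
        have h1 := integral_add (integrable_const (μ := ν) (1 : ℝ)) (hi.add hi2)
        have h2 := integral_add hi hi2
        simp only [Pi.add_apply, integral_const, probReal_univ, smul_eq_mul, mul_one] at h1 h2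
        rw [h1, h2]
    _ ≤ _ := by
        have := Real.add_one_le_exp (∫ u, h u ∂ν + ∫ u, h u ^ 2 ∂ν)
        linarith

/-- Chernoff bound for a sum of independent variables on a product space. -/
theorem pi_le_sum_le_exp {h : ι → U → ℝ} (hm : ∀ i, Measurable (h i))
    (hb : ∀ i, ∀ᵐ u ∂ν, |h i u| ≤ 1) (a c : ℝ)
    (hc : ∑ i, (∫ u, h i u ∂ν + ∫ u, h i u ^ 2 ∂ν) ≤ c) :
    Measure.pi (fun _ : ι => ν) {u | a ≤ ∑ i, h i (u i)} ≤ ENNReal.ofReal (Real.exp (c - a)) := by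
  have hie : ∀ i, Integrable (fun u => Real.exp (h i u)) ν := fun i => by
    refine Integrable.of_bound (hm i).exp.aestronglyMeasurable (Real.exp 1) ?_
    filter_upwards [hb i] with u hu
    rw [Real.norm_eq_abs, Real.abs_exp]
    exact Real.exp_le_exp.2 ((le_abs_self _).trans hu)
  have hprod : Integrable (fun u : ι → U => Real.exp (1 * ∑ i, h i (u i)))
      (Measure.pi fun _ => ν) := by
    simp only [one_mul, Real.exp_sum]
    exact Integrable.fintype_prod hie
  have key := measure_ge_le_exp_mul_mgf (μ := Measure.pi (fun _ : ι => ν))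
    (X := fun u => ∑ i, h i (u i)) a zero_le_one hprod
  have hmgf : mgf (fun u : ι → U => ∑ i, h i (u i)) (Measure.pi fun _ => ν) 1 ≤ Real.exp c := by
    simp only [mgf, one_mul, Real.exp_sum]
    rw [integral_fintype_prod_eq_prod (fun i u => Real.exp (h i u))]
    refine (Finset.prod_le_prod (fun i _ => integral_nonneg fun u => (Real.exp_pos _).le)
      fun i _ => integral_exp_le_of_abs_le_one (hm i) (hb i)).trans ?_
    rw [← Real.exp_sum]
    exact Real.exp_le_exp.2 hc
  rw [← ofReal_measureReal]
  refine ENNReal.ofReal_le_ofReal (key.trans ?_)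
  rw [sub_eq_add_neg, add_comm, Real.exp_add, neg_one_mul]
  gcongr

/-- The number of sample points in a set of probability at most `p` exceeds three times its
expected bound with exponentially small probability. -/
theorem pi_le_sum_indicator_le_exp {B : Set U} (hB : MeasurableSet B) {p : ℝ}
    (hp : ν.real B ≤ p) :
    Measure.pi (fun _ : ι => ν) {u | 3 * (Fintype.card ι * p) ≤
      ∑ i, B.indicator (fun _ => (1 : ℝ)) (u i)} ≤
      ENNReal.ofReal (Real.exp (-(Fintype.card ι * p))) := by
  have hsq : ∀ u, B.indicator (fun _ => (1 : ℝ)) u ^ 2 = B.indicator (fun _ => (1 : ℝ)) u := by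
    intro u; by_cases hu : u ∈ B <;> simp [hu]
  -- An indicator equals its square, so first and second moments together give at most 2np; the
  -- threshold 3np leaves exp(-np).
  refine (pi_le_sum_le_exp (ν := ν) (h := fun _ : ι => B.indicator (fun _ => (1 : ℝ)))
    (fun _ => measurable_const.indicator hB) (fun _ => ae_of_all _ fun u => ?_) _
    (2 * (Fintype.card ι * p)) ?_).trans (le_of_eq ?_)
  · by_cases hu : u ∈ B <;> simp [hu]
  · have : ∫ u, B.indicator (fun _ => (1 : ℝ)) u ∂ν = ν.real B := by
      rw [integral_indicator_const _ hB]; simp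
    simp only [hsq, this, Finset.sum_const, nsmul_eq_mul, Finset.card_univ]
    have : (0 : ℝ) ≤ Fintype.card ι := Nat.cast_nonneg _
    nlinarith
  · congr 2; ring

/-- Markov's inequality; the strict inequality keeps it valid when the mean of |F| is zero. It
allows |F| to be replaced by L times its mean, which turns an L₁ net into a bound valid for each
sample. -/
theorem measure_mul_integral_abs_lt_le {F : U → ℝ} (hi : Integrable F ν)
    {L : ℝ} (hL : 0 < L) :
    ν {u | L * ∫ v, |F v| ∂ν < |F u|} ≤ ENNReal.ofReal (1 / L) := by
  set b := ∫ v, |F v| ∂ν with hb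
  have hb0 : 0 ≤ b := integral_nonneg fun _ => abs_nonneg _
  rcases hb0.eq_or_lt with h0 | h0
  · have hz : ∀ᵐ u ∂ν, |F u| = 0 :=
      (integral_eq_zero_iff_of_nonneg (fun _ => abs_nonneg _) hi.abs).1 (hb.symm.trans h0.symm)
    have : ν {u | L * b < |F u|} = 0 := by
      rw [measure_eq_zero_iff_ae_notMem]
      filter_upwards [hz] with u hu
      simp [hu, ← h0]
    simp [this]
  · have hM := mul_meas_ge_le_integral_of_nonneg (μ := ν) (f := fun u => |F u|)
      (ae_of_all _ fun _ => abs_nonneg _) hi.abs (L * b)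
    have hsub : ν.real {u | L * b < |F u|} ≤ ν.real {u | L * b ≤ |F u|} :=
      by
      refine measureReal_mono fun u hu => ?_
      rw [mem_ofPred_eq] at hu ⊢
      exact hu.le
    rw [← ofReal_measureReal]
    refine ENNReal.ofReal_le_ofReal (hsub.trans ?_)
    rw [le_div_iff₀ hL]
    rw [← hb] at hM
    have : b * (ν.real {u | L * b ≤ |F u|} * L) ≤ b * 1 := by linarith
    exact le_of_mul_le_mul_left this h0

/-- Uniform lower deviation bound for weighted sums of independent bounded variables. The weights
range over a set `V` with a finite net `T` in the `L₁` distance weighted by the absolute moments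
of the variables. -/
theorem pi_exists_weighted_sum_lt_le {F : ι → U → ℝ} (hF : ∀ i, Measurable (F i)) {M : ℝ}
    (hM : ∀ i, ∀ᵐ u ∂ν, |F i u| ≤ M) {V : Set (ι → ℝ)} (hV : ∀ v ∈ V, ∀ i, 0 ≤ v i ∧ v i ≤ M)
    {T : Finset (ι → ℝ)} (hTV : ∀ t ∈ T, t ∈ V) {r L s l : ℝ} (hL : 0 < L)
    (hnet : ∀ v ∈ V, ∃ t ∈ T, ∑ i, (∫ u, |F i u| ∂ν) * |v i - t i| ≤ r) (hrL : L * r ≤ s / 2)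
    (hl : 0 < l) (hlM : l * M ^ 2 ≤ 1)
    (hdrift : ∀ t ∈ T, -(s / 4) ≤ ∑ i, t i * (∫ u, F i u ∂ν - l * M ^ 3)) :
    Measure.pi (fun _ : ι => ν) {u | ∃ v ∈ V, ∑ i, v i * F i (u i) < -s} ≤
      Fintype.card ι * ENNReal.ofReal (1 / L) +
        T.card * ENNReal.ofReal (Real.exp (-(l * s / 4))) := by
  have hint : ∀ i, Integrable (F i) ν := fun i =>
    Integrable.of_bound (hF i).aestronglyMeasurable M (hM i)
  -- Unless some |F i| exceeds L times its mean, replacing v by its net point changes the sum by at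
  -- most L r ≤ s/2.
  have hsub : {u : ι → U | ∃ v ∈ V, ∑ i, v i * F i (u i) < -s} ⊆
      (⋃ i, {u | L * ∫ v, |F i v| ∂ν < |F i (u i)|}) ∪
        ⋃ t ∈ T, {u | l * s / 2 ≤ ∑ i, -(l * t i) * F i (u i)} := by
    rintro u ⟨v, hv, hlt⟩
    by_cases hu : ∃ i, L * ∫ v, |F i v| ∂ν < |F i (u i)|
    · exact Or.inl (mem_iUnion.2 hu)
    push Not at hu
    obtain ⟨t, ht, hvt⟩ := hnet v hv
    refine Or.inr (mem_iUnion₂.2 ⟨t, ht, ?_⟩)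
    have hdiff : ∑ i, t i * F i (u i) - ∑ i, v i * F i (u i) ≤ s / 2 := by
      rw [← Finset.sum_sub_distrib]
      calc ∑ i, (t i * F i (u i) - v i * F i (u i))
          ≤ ∑ i, L * ((∫ u, |F i u| ∂ν) * |v i - t i|) := by
            refine Finset.sum_le_sum fun i _ => ?_
            calc t i * F i (u i) - v i * F i (u i) ≤ |(v i - t i) * F i (u i)| := by
                  rw [← abs_neg]; refine le_trans (le_of_eq ?_) (le_abs_self _); ring
              _ = |F i (u i)| * |v i - t i| := by rw [abs_mul, mul_comm]
              _ ≤ (L * ∫ v, |F i v| ∂ν) * |v i - t i| := by gcongr; exact hu i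
              _ = _ := by ring
        _ = L * ∑ i, (∫ u, |F i u| ∂ν) * |v i - t i| := by rw [Finset.mul_sum]
        _ ≤ L * r := by gcongr
        _ ≤ s / 2 := hrL
    have h1 : ∑ i, t i * F i (u i) < -(s / 2) := by linarith
    have h2 : ∑ i, -(l * t i) * F i (u i) = -(l * ∑ i, t i * F i (u i)) := by
      rw [Finset.mul_sum, ← Finset.sum_neg_distrib]
      exact Finset.sum_congr rfl fun i _ => by ring
    show l * s / 2 ≤ _
    rw [h2]
    nlinarith
  refine (measure_mono hsub).trans ((measure_union_le _ _).trans (add_le_add ?_ ?_))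
  · suffices h : ∀ i, Measure.pi (fun _ : ι => ν) {u | L * ∫ v, |F i v| ∂ν < |F i (u i)|} ≤
        ENNReal.ofReal (1 / L) by
      refine (measure_iUnion_fintype_le _ _).trans ((Finset.sum_le_sum fun i _ => h i).trans ?_)
      simp
    intro i
    have hmp := measurePreserving_eval (fun _ : ι => ν) i
    have := hmp.measure_preimage (s := {x | L * ∫ v, |F i v| ∂ν < |F i x|})
      (measurableSet_lt measurable_const (hF i).abs).nullMeasurableSet
    exact (le_of_eq this).trans (measure_mul_integral_abs_lt_le (hint i) hL)
  · suffices h : ∀ t ∈ T, Measure.pi (fun _ : ι => ν) {u | l * s / 2 ≤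
        ∑ i, -(l * t i) * F i (u i)} ≤ ENNReal.ofReal (Real.exp (-(l * s / 4))) by
      refine (measure_biUnion_finset_le _ _).trans ((Finset.sum_le_sum h).trans ?_)
      simp
    intro t ht
    have htb := hV t (hTV t ht)
    have hab : ∀ i, ∀ᵐ u ∂ν, |-(l * t i) * F i u| ≤ 1 := fun i => by
      filter_upwards [hM i] with u hu
      rw [abs_mul, abs_neg, abs_mul, abs_of_pos hl, abs_of_nonneg (htb i).1]
      have h0 := htb i
      have hM0 : 0 ≤ M := h0.1.trans h0.2
      calc l * t i * |F i u| ≤ l * M * M := by gcongr; exact h0.2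
        _ ≤ 1 := by linarith [hlM, sq M]
    refine (pi_le_sum_le_exp (ν := ν) (h := fun i u => -(l * t i) * F i u)
      (fun i => (hF i).const_mul _) hab _ (l * s / 4) ?_).trans (le_of_eq ?_)
    · have hterm : ∀ i, ∫ u, -(l * t i) * F i u ∂ν + ∫ u, (-(l * t i) * F i u) ^ 2 ∂ν ≤
          -l * (t i * (∫ u, F i u ∂ν - l * M ^ 3)) := fun i => by
        obtain ⟨h0, h1⟩ := htb i
        have hM0 : 0 ≤ M := h0.trans h1
        -- Only one of the two factors t i is bounded by M: the remaining one makes the term a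
        -- multiple of the weight, to be absorbed by the drift.
        have hsq : ∫ u, (-(l * t i) * F i u) ^ 2 ∂ν ≤ l ^ 2 * t i * M ^ 3 := by
          have hle : ∀ᵐ u ∂ν, (-(l * t i) * F i u) ^ 2 ≤ l ^ 2 * t i * M ^ 3 := by
            filter_upwards [hM i] with u hu
            calc (-(l * t i) * F i u) ^ 2 = l ^ 2 * t i * (t i * |F i u| ^ 2) := by
                  rw [sq_abs]; ring
              _ ≤ l ^ 2 * t i * (M * M ^ 2) := by gcongr
              _ = _ := by ring
          refine (integral_mono_of_nonneg (ae_of_all _ fun u => sq_nonneg _)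
            (integrable_const _) hle).trans (le_of_eq (by simp))
        rw [integral_const_mul]
        nlinarith
      refine (Finset.sum_le_sum fun i _ => hterm i).trans ?_
      rw [← Finset.mul_sum]
      have := hdrift t ht
      nlinarith
    · congr 2; ring

end ProductSpace


/-! ### Nets inside a class from covering numbers -/

section Covering

variable {Z : Type*} [MeasurableSpace Z]

theorem exists_isL1Cover_card_le {Q : Measure Z} {ε c : ℝ} {F : Set (Z → ℝ)}
    (h : (coveringNumber ε F Q : ℝ≥0∞) ≤ ENNReal.ofReal c) :
    ∃ T : Finset (Z → ℝ), IsL1Cover Q ε F T ∧ (T.card : ℝ≥0∞) ≤ ENNReal.ofReal c := by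
  have hne : coveringNumber ε F Q ≠ ⊤ := by
    intro h'
    rw [h'] at h
    simp at h
  unfold coveringNumber at h hne
  rw [iInf_subtype'] at h hne
  have : Nonempty {T : Finset (Z → ℝ) // IsL1Cover Q ε F T} := by
    by_contra hemp
    rw [not_nonempty_iff] at hemp
    exact hne (iInf_of_empty _)
  obtain ⟨T, hT⟩ := ENat.exists_eq_iInf
    (fun T : {T : Finset (Z → ℝ) // IsL1Cover Q ε F T} => ((T : Finset (Z → ℝ)).card : ℕ∞))
  refine ⟨T.1, T.2, ?_⟩
  rw [← hT] at h
  simpa using h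

/-- A finite `L₁` cover at radius `ε` yields a net at radius `2ε` with members in the class. -/
theorem IsL1Cover.exists_subset_net {Q : Measure Z} {ε : ℝ} {F : Set (Z → ℝ)}
    {T : Finset (Z → ℝ)} (hT : IsL1Cover Q ε F T) (hF : ∀ f ∈ F, Measurable f) (hε : 0 ≤ ε) :
    ∃ T' : Finset (Z → ℝ), (∀ f ∈ T', f ∈ F) ∧ T'.card ≤ T.card ∧
      ∀ f ∈ F, ∃ h ∈ T', ∫⁻ z, ‖f z - h z‖ₑ ∂Q ≤ ENNReal.ofReal (2 * ε) := by
  classical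
  -- Each useful center is replaced by a class member within ε of it, which doubles the radius; the
  -- default 0 is filtered out.
  let near (h : Z → ℝ) : Prop := ∃ f ∈ F, ∫⁻ z, ‖f z - h z‖ₑ ∂Q ≤ ENNReal.ofReal ε
  let pick (h : Z → ℝ) : Z → ℝ := if hn : near h then hn.choose else 0
  refine ⟨(T.filter near).image pick, fun f hf => ?_,
    Finset.card_image_le.trans (Finset.card_filter_le _ _), fun f hf => ?_⟩
  · obtain ⟨h, hh, rfl⟩ := Finset.mem_image.1 hf
    have hn := (Finset.mem_filter.1 hh).2
    simp only [pick, dif_pos hn]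
    exact hn.choose_spec.1
  · obtain ⟨h, hhT, hfh⟩ := hT.2 f hf
    have hn : near h := ⟨f, hf, hfh⟩
    refine ⟨pick h, Finset.mem_image.2 ⟨h, Finset.mem_filter.2 ⟨hhT, hn⟩, rfl⟩, ?_⟩
    have hp : ∫⁻ z, ‖pick h z - h z‖ₑ ∂Q ≤ ENNReal.ofReal ε := by
      simp only [pick, dif_pos hn]
      exact hn.choose_spec.2
    calc ∫⁻ z, ‖f z - pick h z‖ₑ ∂Q ≤ ∫⁻ z, (‖f z - h z‖ₑ + ‖pick h z - h z‖ₑ) ∂Q := by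
          refine lintegral_mono fun z => ?_
          have : f z - pick h z = (f z - h z) - (pick h z - h z) := by ring
          rw [this]
          exact enorm_sub_le
      _ = ∫⁻ z, ‖f z - h z‖ₑ ∂Q + ∫⁻ z, ‖pick h z - h z‖ₑ ∂Q :=
          lintegral_add_left ((hF f hf).sub (hT.1 h hhT)).enorm _
      _ ≤ ENNReal.ofReal ε + ENNReal.ofReal ε := add_le_add hfh hp
      _ = ENNReal.ofReal (2 * ε) := by rw [← ENNReal.ofReal_add hε hε, two_mul]

end Covering

/-! ### Conditioning on the first coordinates -/

section Disintegration

variable {X Y : Type*} [MeasurableSpace X] [MeasurableSpace Y]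

/-- A law on `X × Y` is that of `(x, φ x u)` with `u` uniform and independent of `x`. -/
theorem exists_uniform_representation [StandardBorelSpace Y] [Nonempty Y]
    (P : Measure (X × Y)) [IsProbabilityMeasure P] :
    ∃ φ : X → unitInterval → Y, Measurable (Function.uncurry φ) ∧
      P = ((P.map Prod.fst).prod volume).map (fun p => (p.1, φ p.1 p.2)) ∧
      ∀ f : Y → ℝ, Measurable f → Integrable (fun z : X × Y => f z.2) P →
        P[fun z : X × Y => f z.2 | MeasurableSpace.comap Prod.fst inferInstance] =ᵐ[P]
          fun z => ∫ u, f (φ z.1 u) := by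
  obtain ⟨φ, hφ, hmap⟩ :=
    (condDistrib (Prod.snd : X × Y → Y) Prod.fst P).exists_measurable_map_eq_unitInterval
  have hφx : ∀ x, Measurable (φ x) := fun x => hφ.comp measurable_prodMk_left
  have hψ : Measurable fun p : X × unitInterval => (p.1, φ p.1 p.2) := measurable_fst.prodMk hφ
  have : IsProbabilityMeasure (P.map Prod.fst) :=
    Measure.isProbabilityMeasure_map measurable_fst.aemeasurable
  refine ⟨φ, hφ, ?_, fun f hf hfi => ?_⟩
  · have h := compProd_map_condDistrib (mβ := inferInstance) (X := (Prod.fst : X × Y → X))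
      (Y := Prod.snd) (μ := P) measurable_snd.aemeasurable
    simp only [Prod.mk.eta, Measure.map_id'] at h
    refine h.symm.trans (Measure.ext fun s hs => ?_)
    rw [Measure.compProd_apply hs, Measure.map_apply hψ hs, Measure.prod_apply (hψ hs)]
    refine lintegral_congr fun x => ?_
    rw [← hmap x, Measure.map_apply (hφx x) (measurable_prodMk_left hs)]
    rfl
  · refine (condExp_ae_eq_integral_condDistrib measurable_fst measurable_snd.aemeasurable
      hf.stronglyMeasurable hfi).trans (ae_of_all _ fun z => ?_)
    simp only
    rw [← hmap z.1, integral_map (hφx _).aemeasurable hf.aestronglyMeasurable]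

variable {ι : Type*} [Fintype ι]

/-- The sample becomes a function of two independent samples, so that conditioning on the first
coordinates is Fubini's theorem. -/
theorem pi_eq_map_prod_pi {U : Type*} [MeasurableSpace U] {P : Measure (X × Y)} {PX : Measure X}
    {ν : Measure U} [IsProbabilityMeasure P] [IsProbabilityMeasure PX] [IsProbabilityMeasure ν]
    {φ : X → U → Y} (hφ : Measurable (Function.uncurry φ))
    (hP : P = (PX.prod ν).map (fun p => (p.1, φ p.1 p.2))) :
    Measure.pi (fun _ : ι => P) =
      ((Measure.pi fun _ : ι => PX).prod (Measure.pi fun _ : ι => ν)).map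
        (fun p i => (p.1 i, φ (p.1 i) (p.2 i))) := by
  have hψ : Measurable fun p : X × U => (p.1, φ p.1 p.2) := measurable_fst.prodMk hφ
  have hpr : IsProbabilityMeasure ((PX.prod ν).map fun p => (p.1, φ p.1 p.2)) := hP ▸ inferInstance
  have h1 := Measure.pi_map_pi (μ := fun _ : ι => PX.prod ν)
    (f := fun _ p => (p.1, φ p.1 p.2)) (fun _ => hψ.aemeasurable)
  have h2 := (measurePreserving_arrowProdEquivProdArrow X U ι (fun _ => PX)
    (fun _ => ν)).symm.map_eq
  subst hP
  rw [← h1, ← h2, Measure.map_map ?_ (MeasurableEquiv.measurable _)]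
  · rfl
  · exact measurable_pi_lambda _ fun i => hψ.comp (measurable_pi_apply i)

/-- A conditional probability bound given the first coordinates, valid outside an exceptional set,
bounds the probability of an event of the sample. -/
theorem pi_le_of_forall_section_le {U : Type*} [MeasurableSpace U] {P : Measure (X × Y)}
    {PX : Measure X} {ν : Measure U} [IsProbabilityMeasure P] [IsProbabilityMeasure PX]
    [IsProbabilityMeasure ν] {φ : X → U → Y} (hφ : Measurable (Function.uncurry φ))
    (hP : P = (PX.prod ν).map (fun p => (p.1, φ p.1 p.2))) {D : Set (ι → X × Y)}
    (hD : NullMeasurableSet D (Measure.pi fun _ => P)) {B : Set (ι → X)} (hB : MeasurableSet B)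
    {δ : ℝ≥0∞} (h : ∀ᵐ x ∂Measure.pi (fun _ : ι => PX), x ∉ B →
      Measure.pi (fun _ : ι => ν) {u | (fun i => (x i, φ (x i) (u i))) ∈ D} ≤ δ) :
    Measure.pi (fun _ => P) D ≤ Measure.pi (fun _ => PX) B + δ := by
  -- Approximation from inside: sections of D' lie in sections of D, so the assumed bound passes to
  -- them.
  obtain ⟨D', hsub, hD', hae⟩ := hD.exists_measurable_subset_ae_eq
  have hψ : Measurable fun p : (ι → X) × (ι → U) => fun i => (p.1 i, φ (p.1 i) (p.2 i)) := by
    refine measurable_pi_lambda _ fun i => ?_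
    have h1 : Measurable fun p : (ι → X) × (ι → U) => p.1 i :=
      (measurable_pi_apply i).comp measurable_fst
    have h2 : Measurable fun p : (ι → X) × (ι → U) => p.2 i :=
      (measurable_pi_apply i).comp measurable_snd
    exact h1.prodMk (hφ.comp (h1.prodMk h2))
  rw [← measure_congr hae, pi_eq_map_prod_pi hφ hP, Measure.map_apply hψ hD',
    Measure.prod_apply (hψ hD')]
  calc _ ≤ ∫⁻ x, (B.indicator 1 x + δ) ∂Measure.pi (fun _ : ι => PX) := by
        refine lintegral_mono_ae ?_
        filter_upwards [h] with x hx
        by_cases hxB : x ∈ B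
        · simp only [indicator_of_mem hxB, Pi.one_apply]
          exact prob_le_one.trans le_self_add
        · simp only [indicator_of_notMem hxB, zero_add]
          refine (measure_mono ?_).trans (hx hxB)
          exact fun u hu => hsub hu
    _ = _ := by
        rw [lintegral_add_right _ measurable_const, lintegral_indicator_one hB]
        simp

end Disintegration


/-! ### Deviation bounds given the covariates -/

section Conditional

variable {X Y U : Type*} [MeasurableSpace X] [MeasurableSpace Y] [MeasurableSpace U]
  {ν : Measure U} [IsProbabilityMeasure ν] {φ : X → U → Y}

/-- The products of a function of the second coordinate with the members of a class of functions
of the first coordinate. -/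
def productClass (f : Y → ℝ) (H : Set (X → ℝ)) : Set (X × Y → ℝ) :=
  {k | ∃ g ∈ H, k = fun z => f z.2 * g z.1}

/-- Apply the covering bound to the average Q of the conditional laws at the points x i: there the
L₁ distance of two products is 1/n times the weighted distance of their instruments. As Q depends on
x, the bound must be uniform in Q. -/
theorem exists_net_of_coveringNumber_le (hφ : Measurable (Function.uncurry φ)) {f : Y → ℝ}
    (hf : Measurable f) {H : Set (X → ℝ)} (hH : ∀ g ∈ H, Measurable g) {n : ℕ} (hn : 0 < n)
    (x : Fin n → X) (hfi : ∀ i, Integrable (fun u => f (φ (x i) u)) ν) {ε c : ℝ} (hε : 0 ≤ ε)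
    (hcov : ∀ Q : Measure (X × Y), IsProbabilityMeasure Q →
      (coveringNumber ε (productClass f H) Q : ℝ≥0∞) ≤ ENNReal.ofReal c) :
    ∃ T : Finset (Fin n → ℝ), (∀ t ∈ T, ∃ g ∈ H, t = fun i => g (x i)) ∧
      (T.card : ℝ≥0∞) ≤ ENNReal.ofReal c ∧
      ∀ g ∈ H, ∃ t ∈ T,
        ∑ i, (∫ u, |f (φ (x i) u)| ∂ν) * |g (x i) - t i| ≤ 2 * n * ε := by
  classical
  have hψ : ∀ i, Measurable fun u => (x i, φ (x i) u) := fun i =>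
    measurable_const.prodMk (hφ.comp measurable_prodMk_left)
  have hpr : ∀ i, IsProbabilityMeasure (ν.map fun u => (x i, φ (x i) u)) := fun i =>
    Measure.isProbabilityMeasure_map (hψ i).aemeasurable
  have hn0 : (n : ℝ≥0∞) ≠ 0 := by simpa using hn.ne'
  have hntop : (n : ℝ≥0∞) ≠ ⊤ := ENNReal.natCast_ne_top n
  set Q : Measure (X × Y) := (n : ℝ≥0∞)⁻¹ • ∑ i, ν.map fun u => (x i, φ (x i) u) with hQ
  have hQp : IsProbabilityMeasure Q := ⟨by
    simp [hQ, ENNReal.inv_mul_cancel hn0 hntop]⟩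
  have hFm : ∀ k ∈ productClass f H, Measurable k := by
    rintro k ⟨g, hg, rfl⟩
    exact (hf.comp measurable_snd).mul ((hH g hg).comp measurable_fst)
  obtain ⟨T₀, hT₀, hcard₀⟩ := exists_isL1Cover_card_le (hcov Q hQp)
  obtain ⟨T, hTF, hTcard, hnet⟩ := hT₀.exists_subset_net hFm hε
  choose! pick hpick hpick' using hTF
  refine ⟨T.image fun k i => pick k (x i), fun t ht => ?_, ?_, fun g hg => ?_⟩
  · obtain ⟨k, hk, rfl⟩ := Finset.mem_image.1 ht
    exact ⟨pick k, hpick k hk, rfl⟩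
  · refine le_trans ?_ hcard₀
    exact_mod_cast Finset.card_image_le.trans hTcard
  · obtain ⟨k, hk, hgk⟩ := hnet _ ⟨g, hg, rfl⟩
    refine ⟨_, Finset.mem_image_of_mem _ hk, ?_⟩
    have hval : ∀ i, ∫⁻ z, ‖f z.2 * g z.1 - k z‖ₑ ∂(ν.map fun u => (x i, φ (x i) u)) =
        ENNReal.ofReal ((∫ u, |f (φ (x i) u)| ∂ν) * |g (x i) - pick k (x i)|) := fun i => by
      have hmeas : Measurable fun z : X × Y => ‖f z.2 * g z.1 - k z‖ₑ :=
        ((hFm _ ⟨g, hg, rfl⟩).sub (hFm k (by rw [hpick' k hk]; exact ⟨_, hpick k hk, rfl⟩))).enorm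
      rw [lintegral_map hmeas (hψ i), ← integral_mul_const,
        ofReal_integral_eq_lintegral_ofReal ((hfi i).abs.mul_const _)
          (ae_of_all _ fun u => by positivity)]
      refine lintegral_congr fun u => ?_
      have hkz : k (x i, φ (x i) u) = f (φ (x i) u) * pick k (x i) := congrFun (hpick' k hk) _
      simp only [hkz]
      rw [← abs_mul, ← Real.norm_eq_abs, ofReal_norm, mul_sub]
    have hsum : ENNReal.ofReal (∑ i, (∫ u, |f (φ (x i) u)| ∂ν) * |g (x i) - pick k (x i)|) ≤
        ENNReal.ofReal (2 * n * ε) := by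
      rw [hQ, lintegral_smul_measure, lintegral_finsetSum_measure] at hgk
      simp only [hval] at hgk
      rw [← ENNReal.ofReal_sum_of_nonneg (fun i _ => mul_nonneg
        (integral_nonneg fun _ => abs_nonneg _) (abs_nonneg _)), smul_eq_mul,
        ENNReal.inv_mul_le_iff hn0 hntop] at hgk
      refine hgk.trans (le_of_eq ?_)
      rw [← ENNReal.ofReal_natCast n, ← ENNReal.ofReal_mul (Nat.cast_nonneg n)]
      congr 1; ring
    exact (ENNReal.ofReal_le_ofReal_iff (by positivity)).1 hsum

/-- Uniform lower deviation bound, conditional on the first coordinates `x` of the sample. -/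
theorem pi_exists_product_sum_lt_le (hφ : Measurable (Function.uncurry φ)) {f : Y → ℝ}
    (hf : Measurable f) {H : Set (X → ℝ)} (hH : ∀ g ∈ H, Measurable g) {n : ℕ} (hn : 0 < n)
    (x : Fin n → X) {M : ℝ} (hM : ∀ i, ∀ᵐ u ∂ν, |f (φ (x i) u)| ≤ M)
    (hHM : ∀ g ∈ H, ∀ i, 0 ≤ g (x i) ∧ g (x i) ≤ M) {ε c : ℝ} (hε : 0 ≤ ε)
    (hcov : ∀ Q : Measure (X × Y), IsProbabilityMeasure Q →
      (coveringNumber ε (productClass f H) Q : ℝ≥0∞) ≤ ENNReal.ofReal c)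
    {L s l : ℝ} (hL : 0 < L) (hLs : L * (2 * n * ε) ≤ s / 2) (hl : 0 < l) (hlM : l * M ^ 2 ≤ 1)
    (hdrift : ∀ g ∈ H, -(s / 4) ≤ ∑ i, g (x i) * (∫ u, f (φ (x i) u) ∂ν - l * M ^ 3)) :
    Measure.pi (fun _ : Fin n => ν) {u | ∃ g ∈ H, ∑ i, f (φ (x i) (u i)) * g (x i) < -s} ≤
      n * ENNReal.ofReal (1 / L) + ENNReal.ofReal c * ENNReal.ofReal (Real.exp (-(l * s / 4))) := by
  have hfm : ∀ i, Measurable fun u => f (φ (x i) u) := fun i =>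
    hf.comp (hφ.comp measurable_prodMk_left)
  obtain ⟨T, hTH, hTc, hnet⟩ := exists_net_of_coveringNumber_le hφ hf hH hn x
    (fun i => Integrable.of_bound (hfm i).aestronglyMeasurable M (hM i)) hε hcov
  have key := pi_exists_weighted_sum_lt_le (ν := ν) (F := fun i u => f (φ (x i) u)) hfm hM
    (V := {v | ∃ g ∈ H, v = fun i => g (x i)}) (by rintro v ⟨g, hg, rfl⟩ i; exact hHM g hg i)
    hTH hL (r := 2 * n * ε) (by rintro v ⟨g, hg, rfl⟩; exact hnet g hg) hLs hl hlM
    (fun t ht => by obtain ⟨g, hg, rfl⟩ := hTH t ht; exact hdrift g hg)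
  rw [Fintype.card_fin] at key
  refine (measure_mono ?_).trans (key.trans ?_)
  · rintro u ⟨g, hg, hlt⟩
    refine ⟨_, ⟨g, hg, rfl⟩, ?_⟩
    simpa only [mul_comm] using hlt
  · gcongr

/-- Uniform lower deviation bound for the sample sums over a class of products, when the
conditional mean is bounded below except on a set of small probability. -/
theorem pi_exists_product_sum_lt_le_of_conditional_mean {P : Measure (X × Y)} {PX : Measure X}
    [IsProbabilityMeasure P] [IsProbabilityMeasure PX] {s : ℝ}
    (hφ : Measurable (Function.uncurry φ))
    (hP : P = (PX.prod ν).map (fun p => (p.1, φ p.1 p.2))) {f : Y → ℝ} (hf : Measurable f)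
    {H : Set (X → ℝ)} (hH : ∀ g ∈ H, Measurable g) {n : ℕ} (hn : 0 < n) {M : ℝ} (hM0 : 0 ≤ M)
    (hM : ∀ᵐ x ∂PX, ∀ᵐ u ∂ν, |f (φ x u)| ≤ M) (hHM : ∀ᵐ x ∂PX, ∀ g ∈ H, 0 ≤ g x ∧ g x ≤ M)
    {ε c : ℝ} (hε : 0 ≤ ε) (hcov : ∀ Q : Measure (X × Y), IsProbabilityMeasure Q →
      (coveringNumber ε (productClass f H) Q : ℝ≥0∞) ≤ ENNReal.ofReal c)
    (hD : NullMeasurableSet {z : Fin n → X × Y | ∃ g ∈ H, ∑ i, f (z i).2 * g (z i).1 < -s}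
      (Measure.pi fun _ => P))
    {L l h p : ℝ} (hL : 0 < L) (hLs : L * (2 * n * ε) ≤ s / 2) (hl : 0 < l)
    (hlM : l * M ^ 2 ≤ 1) {B : Set X} (hB : MeasurableSet B) (hBp : PX.real B ≤ p) (hh : 0 ≤ h)
    (hgood : ∀ᵐ x ∂PX, x ∉ B → l * M ^ 3 ≤ ∫ u, f (φ x u) ∂ν)
    (hbad : ∀ᵐ x ∂PX, l * M ^ 3 - h ≤ ∫ u, f (φ x u) ∂ν)
    (hs : M * h * (3 * (n * p)) ≤ s / 4) :
    Measure.pi (fun _ : Fin n => P)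
        {z | ∃ g ∈ H, ∑ i, f (z i).2 * g (z i).1 < -s} ≤
      ENNReal.ofReal (Real.exp (-(n * p))) + (n * ENNReal.ofReal (1 / L) +
        ENNReal.ofReal c * ENNReal.ofReal (Real.exp (-(l * s / 4)))) := by
  have hcount := pi_le_sum_indicator_le_exp (ι := Fin n) hB hBp
  rw [Fintype.card_fin] at hcount
  have hmeas : MeasurableSet {x : Fin n → X | 3 * (n * p) ≤
      ∑ i, B.indicator (fun _ => (1 : ℝ)) (x i)} :=
    measurableSet_le measurable_const (Finset.measurable_sum _ fun i _ =>
      (measurable_const.indicator hB).comp (measurable_pi_apply i))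
  refine (pi_le_of_forall_section_le hφ hP hD hmeas ?_).trans (add_le_add_left hcount _)
  have hall : ∀ q : X → Prop, (∀ᵐ x ∂PX, q x) →
      ∀ᵐ x ∂Measure.pi (fun _ : Fin n => PX), ∀ i, q (x i) := fun q hq =>
    ae_all_iff.2 fun i => (measurePreserving_eval (fun _ : Fin n => PX) i).quasiMeasurePreserving.ae hq
  filter_upwards [hall _ hM, hall _ hHM, hall _ hgood, hall _ hbad] with x h1 h2 h3 h4 hx
  refine pi_exists_product_sum_lt_le hφ hf hH hn x h1 (fun g hg i => h2 i g hg) hε hcov hL hLs hl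
    hlM fun g hg => ?_
  have hx' : ∑ i, B.indicator (fun _ => (1 : ℝ)) (x i) ≤ 3 * (n * p) := by
    have := not_le.1 hx
    exact this.le
  -- Only points in B can have negative drift; each loses at most M h, and there are at most 3np of
  -- them.
  calc -(s / 4) ≤ -(M * h * ∑ i, B.indicator (fun _ => (1 : ℝ)) (x i)) := by
        have : M * h * ∑ i, B.indicator (fun _ => (1 : ℝ)) (x i) ≤ M * h * (3 * (n * p)) := by
          gcongr
        linarith
    _ = ∑ i, -(M * h * B.indicator (fun _ => (1 : ℝ)) (x i)) := by
        rw [Finset.mul_sum, Finset.sum_neg_distrib]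
    _ ≤ _ := by
        refine Finset.sum_le_sum fun i _ => ?_
        obtain ⟨hg0, hg1⟩ := h2 i g hg
        by_cases hxB : x i ∈ B
        · simp only [indicator_of_mem hxB, mul_one]
          have := h4 i
          have h5 : g (x i) * h ≤ M * h := by gcongr
          nlinarith
        · simp only [indicator_of_notMem hxB, mul_zero, neg_zero]
          exact mul_nonneg hg0 (sub_nonneg.2 (h3 i hxB))

end Conditional


/-! ### Parameters close to the identified set -/

/-- Near a frontier point of a relatively closed set there are points at every small distance
from the set, with nearest points on the frontier. -/
theorem exists_infDist_eq_of_mem_frontier {V : Type*} [NormedAddCommGroup V] [NormedSpace ℝ V]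
    [FiniteDimensional ℝ V] {s : Set V} {a : V} (ha : a ∈ frontier s) {r : ℝ} (hr : 0 < r)
    (hs : ∀ b ∈ closure s, b ∈ Metric.ball a r → b ∈ s) :
    ∃ δ₀ > (0 : ℝ), ∀ δ, 0 < δ → δ ≤ δ₀ → ∃ b ∈ Metric.ball a r, ∃ c ∈ Metric.ball a r,
      c ∈ frontier s ∧ dist b c = δ ∧ Metric.infEDist b s = ENNReal.ofReal δ := by
  have hacl : a ∈ closure s := frontier_subset_closure ha
  have hne : s.Nonempty := closure_nonempty_iff.1 ⟨a, hacl⟩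
  have hac : a ∈ closure sᶜ := by
    rw [frontier_eq_closure_inter_closure] at ha
    exact ha.2
  obtain ⟨e, hes, hea⟩ := Metric.mem_closure_iff.1 hac (r / 2) (by positivity)
  have hecl : e ∉ closure s := fun h => hes (hs e h (by
    rw [Metric.mem_ball, dist_comm]; linarith))
  have hpos : 0 < Metric.infDist e s := by
    refine lt_of_le_of_ne Metric.infDist_nonneg fun h => hecl ?_
    rw [Metric.mem_closure_iff_infDist_zero hne]; exact h.symm
  have ha0 : Metric.infDist a s = 0 := (Metric.mem_closure_iff_infDist_zero hne).1 hacl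
  refine ⟨Metric.infDist e s, hpos, fun δ hδ hδ' => ?_⟩
  have hpre : IsPreconnected (Metric.ball a (r / 2)) := (convex_ball a (r / 2)).isPreconnected
  obtain ⟨b, hb, hbδ⟩ := hpre.intermediate_value (Metric.mem_ball_self (by positivity))
    (Metric.mem_ball.2 (by rw [dist_comm]; exact hea)) (Metric.continuous_infDist_pt s).continuousOn
    (show δ ∈ Icc (Metric.infDist a s) (Metric.infDist e s) by rw [ha0]; exact ⟨hδ.le, hδ'⟩)
  simp only at hbδ
  have hbs : b ∈ sᶜ := fun h => by
    rw [Metric.infDist_zero_of_mem h] at hbδ; exact hδ.ne hbδ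
  have hsu : sᶜ ≠ univ := fun h => by
    rw [compl_univ_iff] at h
    exact hne.ne_empty h
  obtain ⟨c, hc, hbc⟩ := exists_mem_frontier_infDist_compl_eq_dist hbs hsu
  rw [compl_compl, hbδ] at hbc
  rw [frontier_compl] at hc
  -- Thus c is within 2 dist b a < r of a; this is why b was sought in the ball of radius r/2.
  have hδr : δ ≤ dist b a := by
    rw [← hbδ, ← Metric.infDist_closure]; exact Metric.infDist_le_dist_of_mem hacl
  rw [Metric.mem_ball] at hb
  refine ⟨b, Metric.mem_ball.2 (by linarith), c, ?_, hc, hbc.symm, ?_⟩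
  · rw [Metric.mem_ball]
    calc dist c a ≤ dist c b + dist b a := dist_triangle _ _ _
      _ < r := by rw [dist_comm c b, ← hbc]; linarith
  · rw [← hbδ, Metric.infDist, ENNReal.ofReal_toReal (Metric.infEDist_ne_top hne)]

section IdentifiedSet

variable {d dX dW dY : ℕ} {Θ : Set (E d)} {m : E dW → E d → Fin dY → ℝ}
  {P : Measure (E dX × E dW)} {mbar : E d → E dX → Fin dY → ℝ}

theorem mem_identifiedSet_iff (hmbar : IsCondMeanVersion Θ m P mbar) {θ : E d} (hθ : θ ∈ Θ) :
    θ ∈ identifiedSet Θ m P ↔ ∀ᵐ x ∂P.map Prod.fst, ∀ j, 0 ≤ mbar θ x j := by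
  have hm : MeasurableSet {x | ∀ j, 0 ≤ mbar θ x j} := by
    simp only [ofPred_forall]
    exact MeasurableSet.iInter fun j => measurableSet_le measurable_const (hmbar θ hθ j).1
  rw [ae_map_iff measurable_fst.aemeasurable hm]
  have hae : ∀ᵐ z ∂P, ∀ j, mbar θ z.1 j =
      (P[fun z => m z.2 θ j | MeasurableSpace.comap Prod.fst inferInstance]) z :=
    ae_all_iff.2 fun j => (hmbar θ hθ j).2
  constructor
  · rintro ⟨-, h⟩
    filter_upwards [h, hae] with z h1 h2 j
    rw [h2 j]; exact h1 j
  · intro h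
    refine ⟨hθ, ?_⟩
    filter_upwards [h, hae] with z h1 h2 j
    rw [← h2 j]; exact h1 j

theorem ae_mem_suppX : ∀ᵐ x ∂P.map Prod.fst, x ∈ suppX P := Measure.support_mem_ae

/-- Along a sequence the exceptional null sets are countably many, so nonnegativity passes to the
limit at almost every x. -/
theorem mem_identifiedSet_of_mem_closure (hmbar : IsCondMeanVersion Θ m P mbar) {θ : E d}
    (hθ : θ ∈ Θ) (hcl : θ ∈ closure (identifiedSet Θ m P))
    (hcont : ∀ x ∈ suppX P, ∀ j, ContinuousAt (fun θ' => mbar θ' x j) θ) :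
    θ ∈ identifiedSet Θ m P := by
  obtain ⟨t, ht, htθ⟩ := mem_closure_iff_seq_limit.1 hcl
  rw [mem_identifiedSet_iff hmbar hθ]
  have hall : ∀ᵐ x ∂P.map Prod.fst, ∀ k j, 0 ≤ mbar (t k) x j :=
    ae_all_iff.2 fun k => (mem_identifiedSet_iff hmbar (ht k).1).1 (ht k)
  filter_upwards [hall, ae_mem_suppX] with x hx hxs j
  exact ge_of_tendsto' ((hcont x hxs j).tendsto.comp htθ) fun k => hx k j

/-- A finite union of balls has small probability under a bounded density. -/
theorem measureReal_biUnion_ball_le {k : ℕ} {μ : Measure (E k)} {f : E k → ℝ≥0∞}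
    {C : ℝ≥0} (hμ : μ = volume.withDensity f) (hC : ∀ x, f x ≤ C) {s : Set (E k)} {N : ℕ}
    (hs : s.encard ≤ N) {ρ : ℝ} (hρ : 0 < ρ) :
    μ.real (⋃ x ∈ s, Metric.ball x ρ) ≤
      (N * C * (volume (Metric.ball (0 : E k) 1)).toReal) * ρ ^ k := by
  have hfin : s.Finite := finite_of_encard_le_coe hs
  obtain ⟨T, rfl⟩ := hfin.exists_finset_coe
  rw [encard_coe_eq_coe_finsetCard] at hs
  have hs' : T.card ≤ N := by exact_mod_cast hs
  set v := volume (Metric.ball (0 : E k) 1) with hv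
  have hvtop : v ≠ ⊤ := measure_ball_lt_top.ne
  have hball : ∀ x : E k, μ (Metric.ball x ρ) ≤ C * (ENNReal.ofReal (ρ ^ k) * v) := fun x => by
    rw [hμ, withDensity_apply _ measurableSet_ball]
    calc ∫⁻ y in Metric.ball x ρ, f y ≤ ∫⁻ _ in Metric.ball x ρ, (C : ℝ≥0∞) :=
          lintegral_mono fun y => hC y
      _ = C * volume (Metric.ball x ρ) := by simp
      _ = _ := by
          rw [Measure.addHaar_ball_of_pos _ _ hρ, finrank_euclideanSpace, Fintype.card_fin]
  have hle : μ (⋃ x ∈ (T : Set (E k)), Metric.ball x ρ) ≤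
      N * (C * (ENNReal.ofReal (ρ ^ k) * v)) := by
    refine (measure_biUnion_finset_le T _).trans ((Finset.sum_le_sum fun x _ => hball x).trans ?_)
    rw [Finset.sum_const, nsmul_eq_mul]
    gcongr
  refine (ENNReal.toReal_mono ?_ hle).trans (le_of_eq ?_)
  · exact ENNReal.mul_ne_top (ENNReal.natCast_ne_top _) (ENNReal.mul_ne_top ENNReal.coe_ne_top
      (ENNReal.mul_ne_top ENNReal.ofReal_ne_top hvtop))
  · simp only [ENNReal.toReal_mul, ENNReal.toReal_natCast, ENNReal.coe_toReal,
      ENNReal.toReal_ofReal (pow_nonneg hρ.le k)]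
    ring

/-- At every small distance `δ` from the identified set there is a parameter at which the
conditional means are at least `-K δ`, and bounded below by a positive multiple of `ρ ^ α` away
from a set of probability of order `ρ ^ dX`. -/
theorem exists_local_alternatives (hmbar : IsCondMeanVersion Θ m P mbar) {α : ℝ}
    (hα : 0 < α) (hsmooth : SmoothnessUpper Θ (identifiedSet Θ m P) P mbar α) :
    ∃ δ₀ > (0 : ℝ), ∃ K > (0 : ℝ), ∃ η > (0 : ℝ), ∃ κ > (0 : ℝ), ∀ δ, 0 < δ → δ ≤ δ₀ →
      ∃ θ ∈ Θ, Metric.infEDist θ (identifiedSet Θ m P) = ENNReal.ofReal δ ∧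
        ∀ ρ > (0 : ℝ), ∃ B : Set (E dX), MeasurableSet B ∧
          (P.map Prod.fst).real B ≤ κ * ρ ^ dX ∧ ∀ j,
            (∀ᵐ x ∂P.map Prod.fst, x ∉ B → η * min (ρ ^ α) η - K * δ ≤ mbar θ x j) ∧
            ∀ᵐ x ∂P.map Prod.fst, -(K * δ) ≤ mbar θ x j := by
  obtain ⟨θ₀, ⟨hfr, hint⟩, B, hB, ⟨K, hK⟩, ⟨η, hη, N, hcontact⟩, ⟨-, f, -, hfd, C, hC⟩, -⟩ :=
    hsmooth
  obtain ⟨r, hr, hball⟩ := Metric.mem_nhds_iff.1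
    (inter_mem hB (mem_interior_iff_mem_nhds.1 hint))
  have hclosed : ∀ b ∈ closure (identifiedSet Θ m P), b ∈ Metric.ball θ₀ r →
      b ∈ identifiedSet Θ m P := fun b hb hbr =>
    mem_identifiedSet_of_mem_closure hmbar (hball hbr).2 hb fun x hx j =>
      (hK b (hball hbr).1 x hx j).1.continuousAt
  obtain ⟨δ₀, hδ₀, hpts⟩ := exists_infDist_eq_of_mem_frontier hfr hr hclosed
  have hv : 0 ≤ (volume (Metric.ball (0 : E dX) 1)).toReal := ENNReal.toReal_nonneg
  refine ⟨δ₀, hδ₀, |K| + 1, by positivity, η, hη,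
    N * C * (volume (Metric.ball (0 : E dX) 1)).toReal + 1, by positivity, fun δ hδ hδ' => ?_⟩
  obtain ⟨b, hb, c, hc, hcfr, hbc, hdist⟩ := hpts δ hδ hδ'
  have hcid := hclosed c (frontier_subset_closure hcfr) hc
  have hnonneg := (mem_identifiedSet_iff hmbar (hball hc).2).1 hcid
  obtain ⟨hcard, hgrow⟩ := hcontact c ⟨hcfr, (hball hc).1⟩
  -- Mean value inequality on the segment from b to c. The growth condition is then used at c, where
  -- the means are almost surely nonnegative and the absolute value drops out.
  have hlip : ∀ x ∈ suppX P, ∀ j, mbar c x j - (|K| + 1) * δ ≤ mbar b x j := fun x hx j => by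
    have h := (convex_ball θ₀ r).norm_image_sub_le_of_norm_fderiv_le
      (f := fun θ' => mbar θ' x j) (C := |K| + 1)
      (fun y hy => (hK y (hball hy).1 x hx j).1)
      (fun y hy => ((hK y (hball hy).1 x hx j).2.trans (le_abs_self K)).trans (by linarith)) hb hc
    rw [← dist_eq_norm c b, dist_comm, hbc, Real.norm_eq_abs] at h
    linarith [le_abs_self (mbar c x j - mbar b x j)]
  refine ⟨b, (hball hb).2, hdist, fun ρ hρ => ⟨⋃ x ∈ contactSet P mbar c, Metric.ball x ρ, ?_, ?_,
    fun j => ⟨?_, ?_⟩⟩⟩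
  · exact (isOpen_biUnion fun _ _ => Metric.isOpen_ball).measurableSet
  · refine (measureReal_biUnion_ball_le hfd hC hcard hρ).trans ?_
    gcongr
    linarith
  · filter_upwards [hnonneg, ae_mem_suppX] with x hx hxs hxB
    obtain ⟨x₀, hx₀, hle⟩ := hgrow x hxs j
    rw [abs_of_nonneg (hx j)] at hle
    have hρx : ρ ≤ ‖x - x₀‖ := by
      by_contra! hlt
      exact hxB (mem_biUnion hx₀ (by rwa [Metric.mem_ball, dist_eq_norm]))
    have : η * min (ρ ^ α) η ≤ η * min (‖x - x₀‖ ^ α) η := by gcongr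
    linarith [hlip x hxs j]
  · filter_upwards [hnonneg, ae_mem_suppX] with x hx hxs
    linarith [hlip x hxs j, hx j]

end IdentifiedSet


/-! ### Application to the moment inequalities -/

variable {d dX dW dY : ℕ} {Θ : Set (E d)} {m : E dW → E d → Fin dY → ℝ}
  {G : Set (Instr dX dY)} {P : Measure (E dX × E dW)}

/-- The set estimate contains a parameter at which no sample moment is too negative. -/
theorem mem_setEstimate {S : (Fin dY → ℝ) → ℝ≥0} {K₁ c τ W chat : ℝ} (hc : 0 < c)
    (hS : ∀ c > (0 : ℝ), ∀ t, c ≤ (S t : ℝ) → ∃ j, t j ≤ -(c * K₁)) (hτ : 0 ≤ τ)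
    (hτW : W * τ < c * K₁) {w : E d → Instr dX dY → Fin dY → ℝ} {θ : E d} (hθ : θ ∈ Θ)
    (hw : ∀ g ∈ G, ∀ j, 0 ≤ w θ g j ∧ w θ g j ≤ W) (hchat : c ≤ chat) {n : ℕ} (hn : 0 < n)
    {z : ℕ → E dX × E dW} (hz : ∀ j, ∀ g ∈ G,
      -(τ * √n) ≤ ∑ i ∈ Finset.range n, m (z i).2 θ j * (g (z i).1 j : ℝ)) :
    θ ∈ setEstimate Θ m G S w n z chat := by
  have hsq : 0 < √(n : ℝ) := Real.sqrt_pos.2 (by exact_mod_cast hn)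
  have hnR : (0 : ℝ) < n := by exact_mod_cast hn
  have hsup : ksStat m G S (w θ) n z θ ≤ ENNReal.ofReal (c / √n) := by
    refine iSup₂_le fun g hg => ?_
    rw [← ENNReal.ofReal_coe_nnreal]
    refine ENNReal.ofReal_le_ofReal ?_
    by_contra! hlt
    obtain ⟨j, hj⟩ := hS (c / √n) (by positivity) _ hlt.le
    obtain ⟨hw0, hw1⟩ := hw g hg j
    have hmom : -(τ / √n) ≤ sampleMoment m θ g j n z := by
      have h1 : -(τ / √n) = (1 / (n : ℝ)) * -(τ * √n) := by
        have := Real.mul_self_sqrt hnR.le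
        field_simp
        nlinarith
      rw [h1]
      exact mul_le_mul_of_nonneg_left (hz j g hg) (by positivity)
    have h2 : -(W * (τ / √n)) ≤ w θ g j * sampleMoment m θ g j n z := by
      have h3 : w θ g j * (τ / √n) ≤ W * (τ / √n) := by gcongr
      have h4 : w θ g j * -(τ / √n) ≤ w θ g j * sampleMoment m θ g j n z := by gcongr
      linarith
    have h5 : W * (τ / √n) < c / √n * K₁ := by
      have : W * τ / √n < c * K₁ / √n := by gcongr
      calc W * (τ / √n) = W * τ / √n := by ring
        _ < c * K₁ / √n := this
        _ = _ := by ring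
    linarith
  refine ⟨hθ, ?_⟩
  calc ENNReal.ofReal √n * ksStat m G S (w θ) n z θ
      ≤ ENNReal.ofReal √n * ENNReal.ofReal (c / √n) := by gcongr
    _ = ENNReal.ofReal c := by
        rw [← ENNReal.ofReal_mul hsq.le]
        congr 1
        field_simp
    _ ≤ ENNReal.ofReal chat := ENNReal.ofReal_le_ofReal hchat

theorem coveringNumber_mono {Z : Type*} [MeasurableSpace Z] {ε : ℝ} {F F' : Set (Z → ℝ)}
    (h : F ⊆ F') (Q : Measure Z) : coveringNumber ε F Q ≤ coveringNumber ε F' Q :=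
  le_iInf₂ fun T hT => iInf₂_le T ⟨hT.1, fun f hf => hT.2 f (h hf)⟩

/-- The class of `j`-th components of the instruments. -/
def component (G : Set (Instr dX dY)) (j : Fin dY) : Set (E dX → ℝ) :=
  {k | ∃ g ∈ G, k = fun x => (g x j : ℝ)}

theorem productClass_subset_classOne {Ybar : ℝ} {θ : E d} (hθ : θ ∈ Θ) (j : Fin dY) :
    productClass (fun w => m w θ j) (component G j) ⊆ classOne Θ m G Ybar j := by
  rintro _ ⟨_, ⟨g, hg, rfl⟩, rfl⟩
  have h1 : (1 : ℝ) ≤ max Ybar 1 := le_max_right _ _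
  exact ⟨θ, hθ, g, hg, 1, ⟨by linarith, h1⟩, 0, ⟨by linarith, by linarith⟩, by simp⟩

/-- A uniform almost sure bound on the instruments and the moment functions. -/
def UniformBound (Θ : Set (E d)) (m : E dW → E d → Fin dY → ℝ) (G : Set (Instr dX dY))
    (P : Measure (E dX × E dW)) (M : ℝ) : Prop :=
  ∀ᵐ z ∂P, (∀ g ∈ G, ∀ j, (g z.1 j : ℝ) ≤ M) ∧ ∀ θ ∈ Θ, ∀ j, |m z.2 θ j| ≤ M

/-- The event says that the infimum over G is below -s. The almost sure bounds make this infimum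
genuine; for empty G the real infimum is 0 by convention, hence the separate case. -/
theorem nullMeasurableSet_exists_sum_lt [IsProbabilityMeasure P] (hinf : MeasurableInf Θ m G P)
    {M : ℝ} (hM : UniformBound Θ m G P M) {θ : E d} (hθ : θ ∈ Θ) (j : Fin dY) (n : ℕ) (s : ℝ) :
    NullMeasurableSet {z : Fin n → E dX × E dW |
      ∃ k ∈ component G j, ∑ i, m (z i).2 θ j * k (z i).1 < -s}
      (Measure.pi fun _ => P) := by
  rcases G.eq_empty_or_nonempty with rfl | hG
  · simp [component]
  have : Nonempty G := hG.to_subtype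
  refine (nullMeasurableSet_lt (hinf n θ hθ j) (aemeasurable_const (b := -s))).congr ?_
  have hall : ∀ᵐ z ∂Measure.pi (fun _ : Fin n => P), ∀ i,
      (∀ g ∈ G, ∀ j, (g (z i).1 j : ℝ) ≤ M) ∧ ∀ θ ∈ Θ, ∀ j, |m (z i).2 θ j| ≤ M :=
    ae_all_iff.2 fun i =>
      (measurePreserving_eval (fun _ : Fin n => P) i).quasiMeasurePreserving.ae hM
  filter_upwards [hall] with z hz
  have hbdd : BddBelow (range fun g : G => ∑ i, m (z i).2 θ j * (g.1 (z i).1 j : ℝ)) := by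
    refine ⟨∑ _ : Fin n, -(M * M), ?_⟩
    rintro _ ⟨g, rfl⟩
    refine Finset.sum_le_sum fun i _ => ?_
    have h1 := (hz i).1 g.1 g.2 j
    have h2 := (hz i).2 θ hθ j
    have h3 : |m (z i).2 θ j * (g.1 (z i).1 j : ℝ)| ≤ M * M := by
      rw [abs_mul, NNReal.abs_eq]
      exact mul_le_mul h2 h1 (NNReal.coe_nonneg _) ((abs_nonneg _).trans h2)
    exact (abs_le.1 h3).1
  refine propext ((ciInf_lt_iff hbdd).trans ?_)
  constructor
  · rintro ⟨g, hg⟩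
    exact ⟨_, ⟨g.1, g.2, rfl⟩, hg⟩
  · rintro ⟨_, ⟨g, hg, rfl⟩, h⟩
    exact ⟨⟨g, hg⟩, h⟩

/-- Finite sample bound on the probability that some sample moment at `θ` is very negative, when
the conditional mean at `θ` is bounded below except on a set of small probability. -/
theorem pi_exists_moment_lt_le [IsProbabilityMeasure P]
    (hm : ∀ θ ∈ Θ, ∀ j, Measurable fun w => m w θ j) (hG : ∀ g ∈ G, ∀ j, Measurable fun x => g x j)
    (hinf : MeasurableInf Θ m G P) {mbar : E d → E dX → Fin dY → ℝ}
    (hmbar : IsCondMeanVersion Θ m P mbar) {M : ℝ} (hM0 : 0 ≤ M) (hM : UniformBound Θ m G P M)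
    {θ : E d} (hθ : θ ∈ Θ) (j : Fin dY) {n : ℕ} (hn : 0 < n) {Ybar ε c : ℝ} (hε : 0 ≤ ε)
    (hcov : ∀ Q : Measure (E dX × E dW), IsProbabilityMeasure Q →
      (coveringNumber ε (classOne Θ m G Ybar j) Q : ℝ≥0∞) ≤ ENNReal.ofReal c)
    {L s l h p : ℝ} (hL : 0 < L) (hLs : L * (2 * n * ε) ≤ s / 2) (hl : 0 < l)
    (hlM : l * M ^ 2 ≤ 1) {B : Set (E dX)} (hB : MeasurableSet B)
    (hBp : (P.map Prod.fst).real B ≤ p) (hh : 0 ≤ h)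
    (hgood : ∀ᵐ x ∂P.map Prod.fst, x ∉ B → l * M ^ 3 ≤ mbar θ x j)
    (hbad : ∀ᵐ x ∂P.map Prod.fst, l * M ^ 3 - h ≤ mbar θ x j)
    (hs : M * h * (3 * (n * p)) ≤ s / 4) :
    Measure.pi (fun _ : Fin n => P)
        {z | ∃ k ∈ component G j, ∑ i, m (z i).2 θ j * k (z i).1 < -s} ≤
      ENNReal.ofReal (Real.exp (-(n * p))) + (n * ENNReal.ofReal (1 / L) +
        ENNReal.ofReal c * ENNReal.ofReal (Real.exp (-(l * s / 4)))) := by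
  obtain ⟨φ, hφ, hP, hcond⟩ := exists_uniform_representation P
  have : IsProbabilityMeasure (P.map Prod.fst) :=
    Measure.isProbabilityMeasure_map measurable_fst.aemeasurable
  have hψ : Measurable fun p : E dX × unitInterval => (p.1, φ p.1 p.2) := measurable_fst.prodMk hφ
  have hsec : ∀ q : E dX × E dW → Prop, (∀ᵐ z ∂P, q z) →
      ∀ᵐ x ∂P.map Prod.fst, ∀ᵐ u : unitInterval, q (x, φ x u) := fun q hq => by
    rw [hP] at hq
    exact Measure.ae_ae_of_ae_prod (ae_of_ae_map hψ.aemeasurable hq)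
  have hint : Integrable (fun z : E dX × E dW => m z.2 θ j) P :=
    Integrable.of_bound ((hm θ hθ j).comp measurable_snd).aestronglyMeasurable M
      (hM.mono fun z hz => hz.2 θ hθ j)
  have hmean : ∀ᵐ x ∂P.map Prod.fst, mbar θ x j = ∫ u, m (φ x u) θ j := by
    filter_upwards [hsec _ ((hmbar θ hθ j).2.trans (hcond _ (hm θ hθ j) hint))] with x hx
    exact hx.exists.choose_spec
  refine pi_exists_product_sum_lt_le_of_conditional_mean (PX := P.map Prod.fst) hφ hP (hm θ hθ j)
    (H := component G j) ?_ hn hM0 ?_ ?_ hε ?_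
    (nullMeasurableSet_exists_sum_lt hinf hM hθ j n s) hL hLs hl hlM hB hBp hh ?_ ?_ hs
  · rintro _ ⟨g, hg, rfl⟩
    exact measurable_coe_nnreal_real.comp (hG g hg j)
  · filter_upwards [hsec _ hM] with x hx
    exact hx.mono fun u hu => hu.2 θ hθ j
  · filter_upwards [hsec _ hM] with x hx
    rintro _ ⟨g, hg, rfl⟩
    obtain ⟨u, hu⟩ := hx.exists
    exact ⟨NNReal.coe_nonneg _, hu.1 g hg j⟩
  · intro Q hQ
    refine le_trans ?_ (hcov Q hQ)
    exact_mod_cast coveringNumber_mono (productClass_subset_classOne hθ j) Q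
  · filter_upwards [hgood, hmean] with x h1 h2
    rwa [← h2]
  · filter_upwards [hbad, hmean] with x h1 h2
    rwa [← h2]

/-! ### Arithmetic of the exponents -/

section Rates

variable {α k : ℝ}

theorem sqrt_natCast_eq_rpow_mul (hα : 0 < α) (hk : 0 < k) {x : ℝ} (hx : 0 < x) :
    √x = x ^ (k / (2 * k + 2 * α)) * x ^ (α / (2 * k + 2 * α)) := by
  rw [← Real.rpow_add hx, Real.sqrt_eq_rpow]
  congr 1
  field_simp

/-- With ρ^α = aδ the left side is ρ^k, the order of the probability of the contact balls. -/
theorem rpow_contact_radius (hα : 0 < α) (hk : 0 < k) {a ε x : ℝ} (ha : 0 < a) (hε : 0 < ε)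
    (hx : 0 < x) :
    (a * (ε * x ^ (-(α / (2 * k + 2 * α))))) ^ (k / α) =
      (a * ε) ^ (k / α) * x ^ (-(k / (2 * k + 2 * α))) := by
  rw [← mul_assoc, Real.mul_rpow (by positivity) (by positivity), ← Real.rpow_mul hx.le]
  congr 2
  field_simp

theorem tendsto_natCast_rpow_mul_exp_neg {b q : ℝ} (hb : 0 < b) (hq : 0 < q) (v : ℝ) :
    Tendsto (fun n : ℕ => (n : ℝ) ^ v * Real.exp (-(b * (n : ℝ) ^ q))) atTop (𝓝 0) := by
  have h1 := (tendsto_rpow_mul_exp_neg_mul_atTop_nhds_zero (v / q) b hb).comp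
    ((tendsto_rpow_atTop hq).comp tendsto_natCast_atTop_atTop)
  refine h1.congr fun n => ?_
  simp only [Function.comp]
  rw [← Real.rpow_mul (Nat.cast_nonneg n), mul_div_cancel₀ _ hq.ne', neg_mul]

end Rates


/-! ### Choice of constants and the main theorem -/

/-- At distance of order `n ^ (-α / (2 dX + 2 α))` from the identified set there are parameters at
which, with probability tending to one, no sample moment is below `-τ / √n`. -/
theorem exists_alternatives_moment_lt_le [IsProbabilityMeasure P] (hdX : 0 < dX)
    (hm : ∀ θ ∈ Θ, ∀ j, Measurable fun w => m w θ j) (hG : ∀ g ∈ G, ∀ j, Measurable fun x => g x j)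
    (hinf : MeasurableInf Θ m G P) {mbar : E d → E dX → Fin dY → ℝ}
    (hmbar : IsCondMeanVersion Θ m P mbar) {M : ℝ} (hM0 : 0 < M) (hM : UniformBound Θ m G P M)
    {Ybar : ℝ} (hcov : CoveringAssumption Θ m G Ybar) {α : ℝ} (hα : 0 < α)
    (hsmooth : SmoothnessUpper Θ (identifiedSet Θ m P) P mbar α) {τ : ℝ} (hτ : 0 < τ) :
    ∃ ε > (0 : ℝ), ∃ b : ℕ → ℝ, Tendsto b atTop (𝓝 0) ∧ ∀ᶠ n : ℕ in atTop, ∃ θ ∈ Θ,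
      Metric.infEDist θ (identifiedSet Θ m P) =
        ENNReal.ofReal (ε * (n : ℝ) ^ (-(α / (2 * (dX : ℝ) + 2 * α)))) ∧
      ∀ j, Measure.pi (fun _ : Fin n => P)
        {z | ∃ k ∈ component G j, ∑ i, m (z i).2 θ j * k (z i).1 < -(τ * √n)} ≤
          ENNReal.ofReal (b n) := by
  obtain ⟨A, hA, V, hV, hcov⟩ := hcov
  obtain ⟨δ₀, hδ₀, K, hK, η, hη, κ, hκ, hloc⟩ := exists_local_alternatives hmbar hα hsmooth
  have hk : (0 : ℝ) < dX := by exact_mod_cast hdX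
  set γ := α / (2 * (dX : ℝ) + 2 * α) with hγ
  set q := (dX : ℝ) / (2 * (dX : ℝ) + 2 * α) with hq
  have hγ0 : 0 < γ := by positivity
  have hq0 : 0 < q := by positivity
  have hq1 : 0 < 1 - q := by
    rw [hq, sub_pos, div_lt_one (by positivity)]
    linarith
  -- With η ρ^α = R δ, the mean off the balls is at least Rδ - Kδ = M³δ, the drift required for l =
  -- δ.
  set R := K + M ^ 3 with hR
  have hR0 : 0 < R := by positivity
  set D := 3 * M * R * κ with hDdef
  have hD0 : 0 < D := by positivity
  -- The first bound gives C₀ ≤ 1; the second keeps the loss D ε C₀ √n from the contact balls below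
  -- τ√n/4.
  set ε := min (η / R) (τ / (4 * D)) with hε
  have hε0 : 0 < ε := lt_min (by positivity) (by positivity)
  have hεη : R / η * ε ≤ 1 := by
    calc R / η * ε ≤ R / η * (η / R) := by gcongr; exact min_le_left _ _
      _ = 1 := by field_simp
  have hεD : D * ε ≤ τ / 4 := by
    calc D * ε ≤ D * (τ / (4 * D)) := by gcongr; exact min_le_right _ _
      _ = τ / 4 := by field_simp
  set C₀ := (R / η * ε) ^ ((dX : ℝ) / α) with hC₀
  have hC₀0 : 0 < C₀ := by positivity
  have hC₀1 : C₀ ≤ 1 := Real.rpow_le_one (by positivity) hεη (by positivity)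
  set δ : ℕ → ℝ := fun n => ε * (n : ℝ) ^ (-γ) with hδ
  have hδ0 : Tendsto δ atTop (𝓝 0) := by
    have := ((tendsto_rpow_neg_atTop hγ0).comp tendsto_natCast_atTop_atTop).const_mul ε
    simpa [Function.comp_def] using this
  have hsmall : ∀ c > (0 : ℝ), ∀ᶠ n in atTop, δ n ≤ c := fun c hc =>
    (hδ0.eventually (gt_mem_nhds hc)).mono fun n hn => le_of_lt hn
  have hsqrt : ∀ᶠ n : ℕ in atTop, 4 / τ ≤ √(n : ℝ) :=
    (Real.tendsto_sqrt_atTop.comp tendsto_natCast_atTop_atTop).eventually_ge_atTop _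
  refine ⟨ε, hε0, fun n => Real.exp (-(κ * C₀ * (n : ℝ) ^ (1 - q))) + ((n : ℝ)⁻¹ +
    A * ((n : ℝ) ^ (3 * V) * Real.exp (-(ε * τ / 4 * (n : ℝ) ^ q)))), ?_, ?_⟩
  · have h1 := tendsto_natCast_rpow_mul_exp_neg (b := κ * C₀) (by positivity) hq1 0
    simp only [Real.rpow_zero, one_mul] at h1
    have h2 := tendsto_natCast_rpow_mul_exp_neg (b := ε * τ / 4) (by positivity) hq0 (3 * V)
    simpa using h1.add ((tendsto_inv_atTop_nhds_zero_nat (𝕜 := ℝ)).add (h2.const_mul A))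
  -- In order: alternatives exist, l M² ≤ 1, the minimum in the growth condition is ρ^α, the net
  -- error is at most s/2, and the covering radius n^(-3) is below 1.
  filter_upwards [hsmall δ₀ hδ₀, hsmall (1 / M ^ 2) (by positivity),
    hsmall (η / (R / η)) (by positivity), hsqrt, eventually_ge_atTop 2] with n hn1 hn2 hn3 hn4 hn5
  have hn : 0 < n := by omega
  have hnR : (0 : ℝ) < n := by exact_mod_cast hn
  have hδn : 0 < δ n := by positivity
  obtain ⟨θ, hθ, hdist, hρ⟩ := hloc (δ n) hδn hn1
  refine ⟨θ, hθ, hdist, fun j => ?_⟩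
  set ρ := (R / η * δ n) ^ (1 / α) with hρdef
  have hρα : ρ ^ α = R / η * δ n := by
    rw [hρdef, ← Real.rpow_mul (by positivity), one_div_mul_cancel hα.ne', Real.rpow_one]
  have hρk : ρ ^ dX = C₀ * (n : ℝ) ^ (-q) := by
    rw [hρdef, ← Real.rpow_natCast, ← Real.rpow_mul (by positivity), one_div_mul_eq_div]
    exact rpow_contact_radius hα hk (by positivity) hε0 hnR
  obtain ⟨B, hB, hBp, hlow⟩ := hρ ρ (by positivity)
  obtain ⟨hgood, hbad⟩ := hlow j
  have hmin : min (ρ ^ α) η = R / η * δ n := by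
    rw [hρα]
    refine min_eq_left ?_
    calc R / η * δ n ≤ R / η * (η / (R / η)) := by gcongr
      _ = η := by field_simp
  have hsqn := sqrt_natCast_eq_rpow_mul hα hk hnR
  have hsqn' : √(n : ℝ) = n * (n : ℝ) ^ (-q) * (n : ℝ) ^ (-γ) := by
    have h := Real.mul_self_sqrt hnR.le
    have hs0 : √(n : ℝ) ≠ 0 := (Real.sqrt_pos.2 hnR).ne'
    rw [mul_assoc, Real.rpow_neg hnR.le, Real.rpow_neg hnR.le, ← mul_inv, ← hsqn,
      eq_mul_inv_iff_mul_eq₀ hs0]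
    exact h
  have hcov' : ∀ Q : Measure (E dX × E dW), IsProbabilityMeasure Q →
      (coveringNumber ((n : ℝ) ^ (-3 : ℝ)) (classOne Θ m G Ybar j) Q : ℝ≥0∞) ≤
        ENNReal.ofReal (A * (n : ℝ) ^ (3 * V)) := fun Q hQ => by
    have h := hcov j _ (mem_insert _ _) Q hQ ((n : ℝ) ^ (-3 : ℝ)) (by positivity)
      (Real.rpow_lt_one_of_one_lt_of_neg (by exact_mod_cast hn5) (by norm_num))
    rwa [← Real.rpow_mul hnR.le, neg_mul_neg] at h
  have hcube : (n : ℝ) ^ (-3 : ℝ) = ((n : ℝ) ^ 3)⁻¹ := by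
    rw [Real.rpow_neg hnR.le]
    norm_cast
  -- L = n² makes the Markov term n/L vanish, and with radius n^(-3) the net error L · 2n · n^(-3)
  -- is the constant 2.
  have key := pi_exists_moment_lt_le hm hG hinf hmbar hM0.le hM hθ j hn (by positivity) hcov'
    (L := (n : ℝ) ^ 2) (s := τ * √n) (l := δ n) (h := R * δ n) (p := κ * ρ ^ dX) (by positivity)
    (by
      rw [hcube]
      have : (n : ℝ) ^ 2 * (2 * n * ((n : ℝ) ^ 3)⁻¹) = 2 := by field_simp
      rw [this]
      rw [div_le_iff₀ hτ] at hn4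
      linarith)
    hδn (by rwa [le_div_iff₀ (by positivity)] at hn2) hB hBp (by positivity)
    (by
      filter_upwards [hgood] with x hx hxB
      refine le_trans (le_of_eq ?_) (hx hxB)
      rw [hmin, hR]
      field_simp
      ring)
    (by
      filter_upwards [hbad] with x hx
      refine le_trans (le_of_eq ?_) hx
      rw [hR]
      ring)
    (by
      have h1 : M * (R * δ n) * (3 * (n * (κ * ρ ^ dX))) = D * ε * C₀ * √n := by
        rw [hρk, hsqn', hDdef]
        simp only [hδ]
        ring
      rw [h1]
      calc D * ε * C₀ * √n ≤ D * ε * 1 * √n := by gcongr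
        _ ≤ τ / 4 * √n := by rw [mul_one]; gcongr
        _ = τ * √n / 4 := by ring)
  refine key.trans (le_of_eq ?_)
  have e1 : (n : ℝ) * (κ * ρ ^ dX) = κ * C₀ * (n : ℝ) ^ (1 - q) := by
    rw [hρk, sub_eq_add_neg, Real.rpow_add hnR, Real.rpow_one]
    ring
  have e2 : δ n * (τ * √n) / 4 = ε * τ / 4 * (n : ℝ) ^ q := by
    have : (n : ℝ) ^ (-γ) * (n : ℝ) ^ γ = 1 := by
      rw [← Real.rpow_add hnR, neg_add_cancel, Real.rpow_zero]
    rw [hsqn]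
    simp only [hδ]
    linear_combination (ε * τ / 4 * (n : ℝ) ^ q) * this
  have e3 : (n : ℝ≥0∞) * ENNReal.ofReal (1 / (n : ℝ) ^ 2) = ENNReal.ofReal (n : ℝ)⁻¹ := by
    rw [← ENNReal.ofReal_natCast n, ← ENNReal.ofReal_mul hnR.le]
    congr 1
    field_simp
  rw [e1, e2, e3, ← ENNReal.ofReal_mul (by positivity), mul_assoc A,
    ← ENNReal.ofReal_add (by positivity) (by positivity),
    ← ENNReal.ofReal_add (by positivity) (by positivity)]

end KS

theorem mainTheorem5 {d dX dW dY : ℕ} (hdX : 0 < dX)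
    -- the model: parameter space, moment functions, instruments and test function
    (Θ : Set (KS.E d)) (m : KS.E dW → KS.E d → Fin dY → ℝ)
    (G : Set (KS.Instr dX dY)) (S : (Fin dY → ℝ) → ℝ≥0)
    (hm : ∀ θ ∈ Θ, ∀ j, Measurable fun w => m w θ j)
    (hG : ∀ g ∈ G, ∀ j, Measurable fun x => g x j)
    -- the law of `(X, W)` and an iid sample from it
    (P : Measure (KS.E dX × KS.E dW)) [IsProbabilityMeasure P]
    {Ω : Type*} [MeasurableSpace Ω] (μ : Measure Ω) [IsProbabilityMeasure μ]
    (Z : ℕ → Ω → KS.E dX × KS.E dW) (hZ : ∀ i, Measurable (Z i))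
    (hlaw : ∀ i, μ.map (Z i) = P) (hindep : iIndepFun Z μ)
    (hinf : KS.MeasurableInf Θ m G P)
    -- a version of the conditional mean
    (mbar : KS.E d → KS.E dX → Fin dY → ℝ) (hmbar : KS.IsCondMeanVersion Θ m P mbar)
    -- complexity and boundedness of the moments, and the condition on `S`
    (Ybar : ℝ) (hcov : KS.CoveringAssumption Θ m G Ybar)
    (hbdd : KS.BoundedMoments Θ m G P Ybar)
    (hunif : ∃ M : ℝ, ∀ᵐ z ∂P, (∀ g ∈ G, ∀ j, (g z.1 j : ℝ) ≤ M) ∧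
      ∀ θ ∈ Θ, ∀ j, |m z.2 θ j| ≤ M)
    (hS : KS.SAssumption S)
    -- upper bound on the smoothness of the conditional mean
    (α : ℝ) (hα : 0 < α)
    (hsmooth : KS.SmoothnessUpper Θ (KS.identifiedSet Θ m P) P mbar α)
    -- nonnegative, uniformly bounded, possibly data dependent weights
    (wt : ℕ → Ω → KS.E d → KS.Instr dX dY → Fin dY → ℝ)
    (hwt : ∃ wbar : ℝ, ∀ n ω, ∀ θ ∈ Θ, ∀ g ∈ G, ∀ j,
      0 ≤ wt n ω θ g j ∧ wt n ω θ g j ≤ wbar)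
    -- data dependent critical values, bounded away from zero
    (chat : ℕ → Ω → ℝ) (hchat : ∃ c > (0 : ℝ), ∀ n, ∀ᵐ ω ∂μ, c ≤ chat n ω) :
    ∃ ε > (0 : ℝ),
      Tendsto (fun n : ℕ => μ {ω | ENNReal.ofReal ε ≤
          ENNReal.ofReal ((n : ℝ) ^ (α / (2 * (dX : ℝ) + 2 * α))) *
            Metric.hausdorffEDist
              (KS.setEstimate Θ m G S (wt n ω) n (fun i => Z i ω) (chat n ω))
              (KS.identifiedSet Θ m P)})
        atTop (𝓝 1) ∧
      -- also the complementary event has vanishing outer probability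
      Tendsto (fun n : ℕ => μ {ω |
          ENNReal.ofReal ((n : ℝ) ^ (α / (2 * (dX : ℝ) + 2 * α))) *
            Metric.hausdorffEDist
              (KS.setEstimate Θ m G S (wt n ω) n (fun i => Z i ω) (chat n ω))
              (KS.identifiedSet Θ m P) < ENNReal.ofReal ε})
        atTop (𝓝 0) := by
  obtain ⟨c, hc, hchat⟩ := hchat
  obtain ⟨wbar, hwt⟩ := hwt
  obtain ⟨M₀, hM₀⟩ := hunif
  obtain ⟨-, K₁, hK₁, K₂, -, hS⟩ := hS
  have hM : KS.UniformBound Θ m G P (|M₀| + 1) := by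
    filter_upwards [hM₀] with z hz
    have : M₀ ≤ |M₀| + 1 := (le_abs_self _).trans (by linarith)
    exact ⟨fun g hg j => (hz.1 g hg j).trans this, fun θ hθ j => (hz.2 θ hθ j).trans this⟩
  set W := |wbar| + 1 with hW
  have hW0 : 0 < W := by positivity
  set τ := c * K₁ / (2 * W) with hτdef
  have hτ : 0 < τ := by positivity
  have hτW : W * τ < c * K₁ := by
    have h1 : W * τ = c * K₁ / 2 := by rw [hτdef]; field_simp
    rw [h1]
    exact half_lt_self (by positivity)
  obtain ⟨ε, hε, b, hb, hev⟩ := KS.exists_alternatives_moment_lt_le hdX hm hG hinf hmbar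
    (by positivity) hM hcov hα hsmooth hτ
  set far : ℕ → Set Ω := fun n => {ω | ENNReal.ofReal ε ≤
    ENNReal.ofReal ((n : ℝ) ^ (α / (2 * (dX : ℝ) + 2 * α))) * Metric.hausdorffEDist
      (KS.setEstimate Θ m G S (wt n ω) n (fun i => Z i ω) (chat n ω))
      (KS.identifiedSet Θ m P)} with hfar
  set near : ℕ → Set Ω := fun n => {ω |
    ENNReal.ofReal ((n : ℝ) ^ (α / (2 * (dX : ℝ) + 2 * α))) * Metric.hausdorffEDist
      (KS.setEstimate Θ m G S (wt n ω) n (fun i => Z i ω) (chat n ω))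
      (KS.identifiedSet Θ m P) < ENNReal.ofReal ε} with hnear
  have hcompl : ∀ n, near n = (far n)ᶜ := fun n => by
    ext ω
    simp [hfar, hnear]
  have hbound : ∀ᶠ n in atTop, μ (near n) ≤ dY * ENNReal.ofReal (b n) := by
    filter_upwards [hev, eventually_gt_atTop 0] with n ⟨θ, hθ, hdist, hprob⟩ hn
    have hnR : (0 : ℝ) < n := by exact_mod_cast hn
    have hmap : μ.map (fun ω (i : Fin n) => Z i ω) = Measure.pi fun _ => P := by
      have h := (iIndepFun_iff_map_fun_eq_pi_map (f := fun i : Fin n => Z i)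
        (fun i => (hZ i).aemeasurable)).1 (hindep.precomp Fin.val_injective)
      simpa only [hlaw] using h
    have hmeas : Measurable fun ω (i : Fin n) => Z i ω := measurable_pi_lambda _ fun i => hZ i
    have hsub : near n ⊆ {ω | ¬ c ≤ chat n ω} ∪ ⋃ j, (fun ω (i : Fin n) => Z i ω) ⁻¹'
        {z | ∃ k ∈ KS.component G j, ∑ i, m (z i).2 θ j * k (z i).1 < -(τ * √n)} := by
      intro ω hω
      by_contra hcon
      rw [mem_union, not_or, mem_iUnion, not_exists] at hcon
      obtain ⟨hcω, hsum⟩ := hcon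
      have hmem : θ ∈ KS.setEstimate Θ m G S (wt n ω) n (fun i => Z i ω) (chat n ω) := by
        refine KS.mem_setEstimate (K₁ := K₁) hc (fun c hc t => (hS c hc t).1) hτ.le hτW hθ
          (fun g hg j => ⟨(hwt n ω θ hθ g hg j).1, (hwt n ω θ hθ g hg j).2.trans
            ((le_abs_self _).trans (by linarith))⟩) (not_not.1 hcω) hn fun j g hg => ?_
        by_contra! hlt
        refine hsum j ⟨_, ⟨g, hg, rfl⟩, ?_⟩
        rwa [Finset.sum_range] at hlt
      have hle := Metric.infEDist_le_hausdorffEDist_of_mem (t := KS.identifiedSet Θ m P) hmem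
      rw [hdist] at hle
      rw [hnear, mem_ofPred_eq] at hω
      refine absurd hω (not_lt.2 ?_)
      calc ENNReal.ofReal ε = ENNReal.ofReal ((n : ℝ) ^ (α / (2 * (dX : ℝ) + 2 * α))) *
            ENNReal.ofReal (ε * (n : ℝ) ^ (-(α / (2 * (dX : ℝ) + 2 * α)))) := by
            rw [← ENNReal.ofReal_mul (by positivity), mul_left_comm, ← Real.rpow_add hnR,
              add_neg_cancel, Real.rpow_zero, mul_one]
        _ ≤ _ := by gcongr
    calc μ (near n) ≤ μ {ω | ¬ c ≤ chat n ω} + ∑ j, μ ((fun ω (i : Fin n) => Z i ω) ⁻¹'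
          {z | ∃ k ∈ KS.component G j, ∑ i, m (z i).2 θ j * k (z i).1 < -(τ * √n)}) :=
          (measure_mono hsub).trans ((measure_union_le _ _).trans
            (add_le_add_right (measure_iUnion_fintype_le _ _) _))
      _ ≤ 0 + ∑ _ : Fin dY, ENNReal.ofReal (b n) := by
          refine add_le_add (le_of_eq (hchat n)) (Finset.sum_le_sum fun j _ => ?_)
          -- This inequality holds for arbitrary sets, so the event need not be measurable.
          refine (Measure.le_map_apply hmeas.aemeasurable _).trans ?_
          rw [hmap]
          exact hprob j
      _ = dY * ENNReal.ofReal (b n) := by simp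
  have hlim : Tendsto (fun n => (dY : ℝ≥0∞) * ENNReal.ofReal (b n)) atTop (𝓝 0) := by
    have h := ENNReal.Tendsto.const_mul (a := (dY : ℝ≥0∞)) (ENNReal.tendsto_ofReal hb)
      (Or.inr (ENNReal.natCast_ne_top dY))
    simpa using h
  have hnear0 : Tendsto (fun n => μ (near n)) atTop (𝓝 0) :=
    tendsto_of_tendsto_of_tendsto_of_le_of_le' tendsto_const_nhds hlim
      (Eventually.of_forall fun _ => zero_le) hbound
  refine ⟨ε, hε, ?_, hnear0⟩
  have hlow : Tendsto (fun n => 1 - μ (near n)) atTop (𝓝 1) := by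
    have h := ENNReal.Tendsto.sub (tendsto_const_nhds (x := (1 : ℝ≥0∞))) hnear0
      (Or.inl ENNReal.one_ne_top)
    simpa using h
  refine tendsto_of_tendsto_of_tendsto_of_le_of_le hlow tendsto_const_nhds (fun n => ?_)
    fun n => prob_le_one
  -- For outer probabilities, subadditivity still gives 1 ≤ μ (far n) + μ (near n), so the first
  -- limit follows from the second.
  rw [tsub_le_iff_right, hcompl]
  calc (1 : ℝ≥0∞) = μ univ := measure_univ.symm
    _ ≤ _ := by
        rw [← union_compl_self (far n)]
        exact measure_union_le _ _
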